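/- Let $F=\mathbb F_q$ be a finite field with $q$ elements, let $n\ge 1$ and $r\ge 0$ be integers, and put $G=GL_n(F)$. Let $P\subseteq G$ be the subgroup of block upper triangular matrices with diagonal blocks of sizes $1$ and $n-1$, let $L=GL_1(F)\times GL_{n-1}(F)$ be its block diagonal subgroup and $U$ its unipotent radical, and let $e_U=\frac1{|U|}\sum_{u\in U}u\in\mathbb CG$. For a complex $G$-module $V$ let $\mathrm{Resf}(V)=e_UV$, an $L$-module; for an $L$-module $V$ let $\mathrm{Indf}(V)=\mathbb CG\otimes_{\mathbb CP}V$, where $P$ acts on $V$ through $P\to P/U\cong L$. With $\mathbf 1$ the trivial $G$-module, define $$W_q^r=(\mathrm{Indf}\,\mathrm{Resf})^r(\mathbf 1),\qquad W_q^{r+1/2}=\mathrm{Resf}\,(\mathrm{Indf}\,\mathrm{Resf})^r(\mathbf 1),$$ and for $x\in\mathbb CG$ write $x\otimes_U v=x\otimes e_Uv$. Identify $W_q^{r+1/2}=e_UW_q^r$ with its image in $W_q^{r+1}$ under the injective map $v\mapsto 1\otimes v$. For integers $0\le k_1,\dots,k_r\le n-1$ put $k_1^*=0$ and $k_j^*=\min\{k_j,\max\{k_1^*+1,\dots,k_{j-1}^*+1\}\}$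 for $j>1$. The set $\mathcal P_{n\times r}(q)$ of $n$-restricted $q$-set partitions of $\{1,\dots,r\}$ consists of the sequences $K=((k_1,a^{(1)}),\dots,(k_r,a^{(r)}))$ with $0\le k_j\le n-1$ and $a^{(j)}\in F^{k_j-k_j^*}$. Let $s_i(c)=x_{i,i+1}(c)s_i\in G$, where $x_{i,i+1}(c)$ is the matrix with ones on the diagonal, $c$ in position $(i,i+1)$ and zeros elsewhere, and $s_i$ is the permutation matrix switching $i$ and $i+1$. To a column $(k,a)$ with $\ast$-height $k^*$ attach $$\overset{\ast}{w}_{k}(a)=s_k(a_{k-k^*})\cdots s_{k^*+1}(a_1)\;\frac1{q^{k^*}}\sum_{b\in F^{k^*}}s_{k^*}(b_{k^*})\cdots s_1(b_1)\in\mathbb CG,$$ and put $v_K=\overset{\ast}{w}_{k_1}(a^{(1)})\otimes_U\cdots\otimes_U\overset{\ast}{w}_{k_r}(a^{(r)})\otimes_U 1\in W_q^r$. Let $[i]=1+q+\cdots+q^{i-1}$, let $S(r,\ell)$ be the Stirling numbers of the second kind, and let $d_{n,r}(q)=\sum_{\ell=0}^{n}S(r,\ell)\,[n][n-1]\cdots[n-\ell+1]$.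 Theorem. (a) The family $(v_K)_{K\in\mathcal P_{n\times r}(q)}$ is a basis of $W_q^r$ over $\mathbb C$, and $\dim W_q^r=d_{n,r}(q)$. (b) The family $(v_K)$, indexed by the $K\in\mathcal P_{n\times(r+1)}(q)$ with $k_1=0$, is a basis of $W_q^{r+1/2}$ over $\mathbb C$, where $v_K\in W_q^{r+1}$ corresponds under the identification above to the vector $e_U\big(\overset{\ast}{w}_{k_2}(a^{(2)})\otimes_U\cdots\otimes_U\overset{\ast}{w}_{k_{r+1}}(a^{(r+1)})\otimes_U 1\big)$ of $W_q^{r+1/2}$; and $\dim W_q^{r+1/2}=d_{n,r+1}(q)/[n]$. -/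

import Mathlib

open scoped MatrixGroups

noncomputable section

namespace QPartition

universe u

/-! ### The groups `G = GL_n(F)`, `P`, `L`, `U` (row and column numbers start at `0`) -/

section Groups

variable (n : ℕ) [NeZero n] (F : Type u) [Field F]

/-- The parabolic subgroup `P` of block upper triangular matrices with diagonal blocks
of sizes `1` and `n - 1`. -/
def parabolic : Subgroup (GL (Fin n) F) where
  carrier := {g | ∀ i, i ≠ 0 → g.val i 0 = 0}
  one_mem' := fun i hi => by simp [hi]
  mul_mem' := by
    intro a b ha hb i hi
    rw [Units.val_mul, Matrix.mul_apply]
    refine Finset.sum_eq_zero fun k _ => ?_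
    by_cases hk : k = 0
    · subst hk; rw [ha i hi, zero_mul]
    · rw [hb k hk, mul_zero]
  inv_mem' := by
    intro g hg
    have key : ∀ i, g⁻¹.val i 0 * g.val 0 0 = (1 : Matrix (Fin n) (Fin n) F) i 0 := by
      intro i
      have h : (g⁻¹.val * g.val) i 0 = (1 : Matrix (Fin n) (Fin n) F) i 0 := by
        rw [← Units.val_mul, inv_mul_cancel, Units.val_one]
      rw [Matrix.mul_apply, Finset.sum_eq_single 0] at h
      · exact h
      · intro k _ hk; rw [hg k hk, mul_zero]
      · simp
    have h0 : g.val 0 0 ≠ 0 := by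
      intro h
      have := key 0
      simp [h] at this
    intro i hi
    have := key i
    rw [Matrix.one_apply_ne hi] at this
    exact (mul_eq_zero.mp this).resolve_right h0

/-- The Levi subgroup `L = G_1 × G_{n-1}` of block diagonal matrices with blocks of sizes
`1` and `n - 1`. -/
def levi : Subgroup (GL (Fin n) F) where
  carrier := {g | ∀ i j, ¬ (i = 0 ↔ j = 0) → g.val i j = 0}
  one_mem' := fun i j h => by
    have : i ≠ j := by rintro rfl; exact h Iff.rfl
    simp [this]
  mul_mem' := by
    intro a b ha hb i j hij
    rw [Units.val_mul, Matrix.mul_apply]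
    refine Finset.sum_eq_zero fun k _ => ?_
    by_cases hk : i = 0 ↔ k = 0
    · rw [hb k j (fun h => hij (hk.trans h)), mul_zero]
    · rw [ha i k hk, zero_mul]
  inv_mem' := by
    intro g hg
    have hgP : g ∈ parabolic n F := fun i hi => hg i 0 (by simp [hi])
    have hiP := (parabolic n F).inv_mem hgP
    have h0 : g.val 0 0 ≠ 0 := by
      intro h
      have h1 : (g.val * g⁻¹.val) 0 0 = (1 : Matrix (Fin n) (Fin n) F) 0 0 := by
        rw [← Units.val_mul, mul_inv_cancel, Units.val_one]
      rw [Matrix.mul_apply, Finset.sum_eq_zero] at h1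
      · simp at h1
      · intro k _
        by_cases hk : k = 0
        · subst hk; rw [h, zero_mul]
        · rw [hiP k hk, mul_zero]
    intro i j hij
    by_cases hi : i = 0
    · subst hi
      have hj : j ≠ 0 := fun h => hij (by simp [h])
      have h1 : (g.val * g⁻¹.val) 0 j = (1 : Matrix (Fin n) (Fin n) F) 0 j := by
        rw [← Units.val_mul, mul_inv_cancel, Units.val_one]
      rw [Matrix.mul_apply, Finset.sum_eq_single 0, Matrix.one_apply_ne (Ne.symm hj)] at h1
      · exact (mul_eq_zero.mp h1).resolve_left h0
      · intro k _ hk; rw [hg 0 k (by simp [hk]), zero_mul]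
      · simp
    · have hj : j = 0 := by by_contra hj; exact hij (by simp [hi, hj])
      subst hj
      exact hiP i hi

/-- The unipotent radical `U` of `P`: matrices that agree with the identity matrix except
possibly in the entries `(0, j)` with `j ≠ 0`. -/
def unip : Subgroup (GL (Fin n) F) where
  carrier := {g | ∀ i j, (i ≠ 0 ∨ j = 0) → g.val i j = (1 : Matrix (Fin n) (Fin n) F) i j}
  one_mem' := fun i j _ => by simp
  mul_mem' := by
    intro a b ha hb i j hij
    rw [Units.val_mul, Matrix.mul_apply, Finset.sum_eq_single i]
    · by_cases hi : i = 0
      · subst hi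
        rw [ha 0 0 (Or.inr rfl), Matrix.one_apply_eq, one_mul, hb 0 j hij]
      · rw [ha i i (Or.inl hi), Matrix.one_apply_eq, one_mul, hb i j hij]
    · intro k _ hk
      by_cases hi : i = 0
      · subst hi
        have hj : j = 0 := hij.resolve_left (by simp)
        subst hj
        rw [hb k 0 (Or.inr rfl), Matrix.one_apply_ne hk, mul_zero]
      · rw [ha i k (Or.inl hi), Matrix.one_apply_ne (Ne.symm hk), zero_mul]
    · simp
  inv_mem' := by
    intro g hg i j hij
    have hgP : g ∈ parabolic n F := fun k hk => by
      rw [hg k 0 (Or.inl hk), Matrix.one_apply_ne hk]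
    have hiP := (parabolic n F).inv_mem hgP
    by_cases hi : i = 0
    · have hj : j = 0 := hij.resolve_left (by simp [hi])
      subst hi hj
      have h1 : (g⁻¹.val * g.val) 0 0 = (1 : Matrix (Fin n) (Fin n) F) 0 0 := by
        rw [← Units.val_mul, inv_mul_cancel, Units.val_one]
      rw [Matrix.mul_apply, Finset.sum_eq_single 0, hg 0 0 (Or.inr rfl), Matrix.one_apply_eq,
        mul_one] at h1
      · rw [h1, Matrix.one_apply_eq]
      · intro k _ hk; rw [hgP k hk, mul_zero]
      · simp
    · have h1 : (g.val * g⁻¹.val) i j = (1 : Matrix (Fin n) (Fin n) F) i j := by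
        rw [← Units.val_mul, mul_inv_cancel, Units.val_one]
      rw [Matrix.mul_apply, Finset.sum_eq_single i, hg i i (Or.inl hi), Matrix.one_apply_eq,
        one_mul] at h1
      · exact h1
      · intro k _ hk
        rw [hg i k (Or.inl hi), Matrix.one_apply_ne (Ne.symm hk), zero_mul]
      · simp

variable {n F}

/-- The block diagonal part of a matrix, for the blocks of sizes `1` and `n - 1`. -/
def blockDiagPart (M : Matrix (Fin n) (Fin n) F) : Matrix (Fin n) (Fin n) F :=
  Matrix.of fun i j => if (i = 0 ↔ j = 0) then M i j else 0

theorem blockDiagPart_one : blockDiagPart (1 : Matrix (Fin n) (Fin n) F) = 1 := by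
  ext i j
  simp only [blockDiagPart, Matrix.of_apply]
  split_ifs with h
  · rfl
  · rw [Matrix.one_apply_ne]
    rintro rfl
    exact h Iff.rfl

theorem blockDiagPart_mul (M N : Matrix (Fin n) (Fin n) F)
    (hM : ∀ i, i ≠ 0 → M i 0 = 0) (hN : ∀ i, i ≠ 0 → N i 0 = 0) :
    blockDiagPart (M * N) = blockDiagPart M * blockDiagPart N := by
  ext i j
  simp only [blockDiagPart, Matrix.of_apply, Matrix.mul_apply]
  split_ifs with h
  · refine Finset.sum_congr rfl fun k _ => ?_
    by_cases hik : i = 0 ↔ k = 0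
    · rw [if_pos hik, if_pos (hik.symm.trans h)]
    · rw [if_neg hik, zero_mul]
      by_cases hi : i = 0
      · have hk : k ≠ 0 := fun hk => hik (by simp [hi, hk])
        rw [h.mp hi, hN k hk, mul_zero]
      · have hk : k = 0 := by by_contra hk; exact hik (by simp [hi, hk])
        rw [hk, hM i hi, zero_mul]
  · symm
    refine Finset.sum_eq_zero fun k _ => ?_
    by_cases hik : i = 0 ↔ k = 0
    · rw [if_neg (fun hkj => h (hik.trans hkj)), mul_zero]
    · rw [if_neg hik, zero_mul]

variable (n F)

/-- The surjection `P → P/U ≅ L` that sends a block upper triangular matrix to its block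
diagonal part. -/
def toLevi : parabolic n F →* levi n F where
  toFun p :=
    ⟨{ val := blockDiagPart p.val.val
       inv := blockDiagPart p⁻¹.val.val
       val_inv := by
        rw [← blockDiagPart_mul _ _ p.2 (p⁻¹).2, ← Units.val_mul, ← Subgroup.coe_mul,
          mul_inv_cancel]
        exact blockDiagPart_one
       inv_val := by
        rw [← blockDiagPart_mul _ _ (p⁻¹).2 p.2, ← Units.val_mul, ← Subgroup.coe_mul,
          inv_mul_cancel]
        exact blockDiagPart_one },
      fun i j hij => by simp [blockDiagPart, hij]⟩
  map_one' := Subtype.ext <| Units.ext blockDiagPart_one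
  map_mul' p q := Subtype.ext <| Units.ext <| blockDiagPart_mul _ _ p.2 q.2

variable {n F}

theorem levi_conj_unip {l u : GL (Fin n) F} (hl : l ∈ levi n F) (hu : u ∈ unip n F) :
    l * u * l⁻¹ ∈ unip n F := by
  have hli := (levi n F).inv_mem hl
  have key : ∀ i j, (i ≠ 0 ∨ j = 0) → (l * u).val i j = l.val i j := by
    intro i j hij
    rw [Units.val_mul, Matrix.mul_apply, Finset.sum_eq_single j]
    · by_cases hj : j = 0
      · rw [hu j j (Or.inr hj), Matrix.one_apply_eq, mul_one]
      · rw [hu j j (Or.inl hj), Matrix.one_apply_eq, mul_one]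
    · intro k _ hk
      by_cases hk0 : k = 0
      · by_cases hj : j = 0
        · exact absurd (hk0.trans hj.symm) hk
        · rw [hl i k (by simp [hij.resolve_right hj, hk0]), zero_mul]
      · rw [hu k j (Or.inl hk0), Matrix.one_apply_ne hk, mul_zero]
    · simp
  intro i j hij
  have h1 : (l * u * l⁻¹).val i j = (l * l⁻¹).val i j := by
    rw [Units.val_mul (l * u), Units.val_mul l l⁻¹, Matrix.mul_apply, Matrix.mul_apply]
    refine Finset.sum_congr rfl fun k _ => ?_
    by_cases h : i ≠ 0 ∨ k = 0
    · rw [key i k h]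
    · push Not at h
      have hj : j = 0 := hij.resolve_left (by simp [h.1])
      rw [hli k j (by simp [h.2, hj]), mul_zero, mul_zero]
  rw [h1, mul_inv_cancel, Units.val_one]

end Groups

/-! ### Harish-Chandra restriction and induction -/

section HarishChandra

variable (n : ℕ) [NeZero n] (F : Type u) [Field F] [Fintype F]

instance : Fintype (unip n F) := Fintype.ofFinite _

/-- The idempotent `e_U = |U|⁻¹ ∑_{u ∈ U} u` of the group algebra `ℂG`. -/
def eU : MonoidAlgebra ℂ (GL (Fin n) F) :=
  (Fintype.card (unip n F) : ℂ)⁻¹ • ∑ u : unip n F, MonoidAlgebra.of ℂ (GL (Fin n) F) u.val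

variable {n F}

theorem levi_mul_eU (l : levi n F) :
    MonoidAlgebra.of ℂ (GL (Fin n) F) l.val * eU n F =
      eU n F * MonoidAlgebra.of ℂ (GL (Fin n) F) l.val := by
  rw [eU, mul_smul_comm, smul_mul_assoc, Finset.mul_sum, Finset.sum_mul]
  congr 1
  refine Finset.sum_bij' (fun u _ => ⟨l.val * u.val * l.val⁻¹, levi_conj_unip l.2 u.2⟩)
    (fun u _ => ⟨l.val⁻¹ * u.val * l.val, by
      simpa using levi_conj_unip ((levi n F).inv_mem l.2) u.2⟩) ?_ ?_ ?_ ?_ ?_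
  · simp
  · simp
  · intro u _; apply Subtype.ext; simp [mul_assoc]
  · intro u _; apply Subtype.ext; simp [mul_assoc]
  · intro u _; rw [← map_mul, ← map_mul]; simp [mul_assoc]

/-- The operator by which `e_U` acts on a `G`-module `V`. -/
def eUOp (V : Rep.{u} ℂ (GL (Fin n) F)) : V →ₗ[ℂ] V :=
  V.ρ.asAlgebraHom (eU n F)

theorem eUOp_comm (V : Rep.{u} ℂ (GL (Fin n) F)) (l : levi n F) (v : V) :
    V.ρ l.val (eUOp V v) = eUOp V (V.ρ l.val v) := by
  have h := congrArg (fun x => V.ρ.asAlgebraHom x v) (levi_mul_eU l)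
  simpa [eUOp, Module.End.mul_apply] using h

/-- Harish-Chandra restriction: the `L`-module `e_U V` attached to a `G`-module `V`. -/
def Resf (V : Rep.{u} ℂ (GL (Fin n) F)) : Rep.{u} ℂ (levi n F) :=
  Rep.of (X := LinearMap.range (eUOp V))
    { toFun := fun l => (V.ρ l.val).restrict (by
        rintro _ ⟨v, rfl⟩
        exact ⟨V.ρ l.val v, (eUOp_comm V l v).symm⟩)
      map_one' := by ext x; simp
      map_mul' := fun l m => by ext x; simp }

/-- The vector `e_U v` of `e_U V`. -/
def toResf (V : Rep.{u} ℂ (GL (Fin n) F)) : V →ₗ[ℂ] Resf V :=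
  (eUOp V).rangeRestrict

/-- Inflation: an `L`-module regarded as a `P`-module through `P → P/U ≅ L`. -/
def Infl (V : Rep.{u} ℂ (levi n F)) : Rep.{u} ℂ (parabolic n F) :=
  Rep.of (X := V) (V.ρ.comp (toLevi n F))

/-- Harish-Chandra induction: the `G`-module `ℂG ⊗_{ℂP} V`, where the `L`-module `V` is
inflated to `P`. -/
def Indf (V : Rep.{u} ℂ (levi n F)) : Rep.{u} ℂ (GL (Fin n) F) :=
  Rep.ind (parabolic n F).subtype (Infl V)

/-- The tensor `g ⊗ v` in `ℂG ⊗_{ℂP} V`, for `g ∈ G` and `v ∈ V`. The library realizes the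
induced module with `P` acting on `ℂG` by left multiplication and `h ∈ G` acting by right
multiplication by `h⁻¹`; this is turned into the usual convention by `g ↦ g⁻¹`,
see `smul_groupTmul` and `groupTmul_mul`. -/
def groupTmul (V : Rep.{u} ℂ (levi n F)) (g : GL (Fin n) F) : V →ₗ[ℂ] Indf V :=
  Representation.IndV.mk (parabolic n F).subtype (Infl V).ρ g⁻¹

theorem smul_groupTmul (V : Rep.{u} ℂ (levi n F)) (h g : GL (Fin n) F) (v : V) :
    (Indf V).ρ h (groupTmul V g v) = groupTmul V (h * g) v := by
  have := Representation.ind_mk (parabolic n F).subtype (Infl V).ρ h g⁻¹ v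
  rw [← mul_inv_rev] at this
  exact this

theorem groupTmul_mul (V : Rep.{u} ℂ (levi n F)) (g : GL (Fin n) F) (p : parabolic n F) (v : V) :
    groupTmul V (g * p.val) v = groupTmul V g (V.ρ (toLevi n F p) v) := by
  have h := Representation.Coinvariants.mk_inv_tmul
    ((Representation.leftRegular ℂ (GL (Fin n) F)).comp (parabolic n F).subtype) (Infl V).ρ
    (MonoidAlgebra.single g⁻¹ 1) v p
  simp only [MonoidHom.comp_apply, Representation.leftRegular, Representation.ofMulAction_single,
    Subgroup.subtype_apply] at h
  rw [groupTmul, mul_inv_rev]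
  exact h

/-- The tensor `x ⊗ v` in `ℂG ⊗_{ℂP} V`, for `x ∈ ℂG` and `v ∈ V`. -/
def algTmul (V : Rep.{u} ℂ (levi n F)) (x : MonoidAlgebra ℂ (GL (Fin n) F)) (v : V) : Indf V :=
  x.coeff.sum fun g c => c • groupTmul V g v

variable (n F)

/-- The `G`-module `IR^r = (Indf Resf)^r (1)`; `1` is the trivial module `ℂ` (lifted to the
universe of `F`). -/
def IR : ℕ → Rep.{u} ℂ (GL (Fin n) F)
  | 0 => Rep.trivial ℂ (GL (Fin n) F) (ULift.{u} ℂ)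
  | r + 1 => Indf (Resf (IR r))

/-- The `L`-module `IR^{r+1/2} = Resf (Indf Resf)^r (1)`. -/
def IRHalf (r : ℕ) : Rep.{u} ℂ (levi n F) := Resf (IR n F r)

variable {n F}

/-- The vector `x_1 ⊗_U x_2 ⊗_U ⋯ ⊗_U x_r ⊗_U 1` of `IR^r`, for `x_1, …, x_r ∈ ℂG`; here
`x ⊗_U v` is `x ⊗ e_U v`. -/
def iterTmul : (r : ℕ) → (Fin r → MonoidAlgebra ℂ (GL (Fin n) F)) → IR n F r
  | 0, _ => (ULift.up 1 : ULift.{u} ℂ)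
  | r + 1, x => algTmul (Resf (IR n F r)) (x 0)
      (toResf (IR n F r) (iterTmul r (Fin.tail x)))

/-- The map `v ↦ 1 ⊗ v` from `IR^{r+1/2}` to `IR^{r+1}`. -/
def halfIncl (r : ℕ) : IRHalf n F r →ₗ[ℂ] IR n F (r + 1) :=
  groupTmul (Resf (IR n F r)) 1

end HarishChandra

/-! ### `q`-set partitions -/

section QSetPartitions

/-- The `∗`-height of a sequence `k_1, …, k_r`:
`k_j^* = min (k_j, max {k_1^* + 1, …, k_{j-1}^* + 1})`, and `k_1^* = 0`
(the maximum over the empty set is `0`). -/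
def starHeight {r : ℕ} (k : Fin r → ℕ) (j : Fin r) : ℕ :=
  min (k j) (Finset.univ.sup fun i : Fin j.val => starHeight k ⟨i.val, i.2.trans j.2⟩ + 1)
termination_by j.val
decreasing_by exact i.2

theorem starHeight_le {r : ℕ} (k : Fin r → ℕ) (j : Fin r) : starHeight k j ≤ k j := by
  rw [starHeight]
  exact min_le_left _ _

/-- The set `𝒫_{n×r}(q)` of `n`-restricted `q`-set partitions of `{1, …, r}`: heights
`0 ≤ k_j ≤ n - 1` with labels `a^{(j)} ∈ F^{k_j - k_j^*}`, where `q = |F|`. -/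
@[ext]
structure QSetPartition (n r : ℕ) (F : Type u) where
  k : Fin r → Fin n
  a : (j : Fin r) → Fin ((k j).val - starHeight (fun i => (k i).val) j) → F

end QSetPartitions

/-! ### The vectors `v_K` -/

section Vectors

variable {n : ℕ} {F : Type u} [Field F]

/-- The matrix `x_{ij}(a)`, `i ≠ j`, with ones on the diagonal, `a` in position `(i, j)` and
zeros elsewhere. -/
def xElt (i j : Fin n) (hij : i ≠ j) (a : F) : GL (Fin n) F where
  val := Matrix.transvection i j a
  inv := Matrix.transvection i j (-a)
  val_inv := by rw [Matrix.transvection_mul_transvection_same i j hij]; simp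
  inv_val := by rw [Matrix.transvection_mul_transvection_same i j hij]; simp

/-- The element `s_{i+1}(a) = x_{i+1,i+2}(a) s_{i+1}` of `GL_n(F)`; since rows and columns are
numbered from `0` here, the simple reflection `s_{i+1}` switches `i` and `i + 1`. -/
def sElt (i : ℕ) (h : i + 1 < n) (a : F) : GL (Fin n) F :=
  xElt ⟨i, by omega⟩ ⟨i + 1, h⟩ (by simp) a *
    Matrix.GeneralLinearGroup.swap F ⟨i, by omega⟩ ⟨i + 1, h⟩

/-- The product `s_{l+m}(c_m) ⋯ s_{l+2}(c_2) s_{l+1}(c_1)`. -/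
def sProd (l : ℕ) : (m : ℕ) → l + m < n → (Fin m → F) → GL (Fin n) F
  | 0, _, _ => 1
  | m + 1, h, c => sElt (l + m) h (c (Fin.last m)) * sProd l m (by omega) (Fin.init c)

/-- The element of `ℂG` attached to a column of height `k` with `h` starred boxes and labels
`a_1, …, a_{k-h}`:
`s_k(a_{k-h}) ⋯ s_{h+1}(a_1) · q^{-h} ∑_{b ∈ F^h} s_h(b_h) ⋯ s_1(b_1)`. -/
def starW [Fintype F] (k : Fin n) (h : ℕ) (hk : h ≤ k.val) (a : Fin (k.val - h) → F) :
    MonoidAlgebra ℂ (GL (Fin n) F) :=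
  MonoidAlgebra.of ℂ (GL (Fin n) F) (sProd h (k.val - h) (by omega) a) *
    (((Fintype.card F : ℂ) ^ h)⁻¹ •
      ∑ b : Fin h → F, MonoidAlgebra.of ℂ (GL (Fin n) F) (sProd 0 h (by omega) b))

/-- The element of `ℂG` attached to the column `j` of `K`. -/
def QSetPartition.column [Fintype F] {r : ℕ} (K : QSetPartition n r F) (j : Fin r) :
    MonoidAlgebra ℂ (GL (Fin n) F) :=
  starW (K.k j) (starHeight (fun i => (K.k i).val) j)
    (starHeight_le (fun i => (K.k i).val) j) (K.a j)

/-- The vector `v_K ∈ IR^r` of a `q`-set partition `K`. -/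
def vec [NeZero n] [Fintype F] {r : ℕ} (K : QSetPartition n r F) : IR n F r :=
  iterTmul r K.column

/-- The vector `e_U (x_2 ⊗_U ⋯ ⊗_U x_{r+1} ⊗_U 1)` of `IR^{r+1/2}`, where `x_j ∈ ℂG` is attached
to the column `j` of `K`; the first column of `K`, meant to be empty, is omitted. -/
def vecHalf [NeZero n] [Fintype F] {r : ℕ} (K : QSetPartition n (r + 1) F) : IRHalf n F r :=
  toResf (IR n F r) (iterTmul r (Fin.tail K.column))

end Vectors

/-! ### The dimension -/

/-- The `q`-integer `[i] = 1 + q + ⋯ + q^{i-1}`. -/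
def qInt (q i : ℕ) : ℕ := ∑ j ∈ Finset.range i, q ^ j

/-- `d_{n,r}(q) = ∑_{ℓ=0}^{n} S(r,ℓ) [n][n-1]⋯[n-ℓ+1]`. -/
def d (n r q : ℕ) : ℕ :=
  ∑ l ∈ Finset.range (n + 1), Nat.stirlingSecond r l * ∏ i ∈ Finset.range l, qInt q (n - i)

end QPartition

end

namespace QPartition

noncomputable section

universe u

/-! ### `q`-set partitions with an initial `∗`-height -/

/-! The induction on the number of columns does not close on the bases of `IR^r` alone, so a
stronger statement is proved. Let U_h be the group of matrices 1 + N with N strictly upper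
triangular and supported in the first h rows; thus U_0 = 1 and U_1 = U. Let the `∗`-heights start
from the value h instead of 0. Then the averages over U_h of the vectors `v_K`, for all such K, form
a basis of the U_h-fixed vectors of `IR^r` (`avgVec_basis`). The value h = 0 gives (a). The value h
= 1 gives (b), since an empty first column raises the initial value from 0 to 1.

The induction step is Mackey theory for Indf V with V = Resf(`IR^r`). The double cosets U_h\G/P have
representatives g = s_k(c_{k-1})⋯s_1(c_0) with c_i = 0 for i < min(k, h) (`orbitRep_disjoint`,
`orbitRep_cover`); the free entries are the labels of a column of height k and `∗`-height min(k, h).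
The stabilizer of gP in U_h, conjugated into P and projected to L, consists of the Levi parts of
U_{h'}, where h' = `nextHeight h k` (`toLevi_mem_of_conj_mem`, `conj_toLevi_mem`). As h' ≥ 1, the
group U_{h'} contains U, so the stabilizer-fixed vectors of e_U `IR^r` are the U_{h'}-fixed vectors
of `IR^r`, and the induction hypothesis supplies a basis of them. Averaging g ⊗ b over U_h then
gives the new basis (`linearIndependent_avg_groupTmul`, `avg_mem_span_groupTmul`). The starred sum
in a column runs over elements of U_h g, so averaging cannot tell it from g (`avg_algTmul_starW`).

The dimensions follow by counting: splitting off the first column gives a recursion in (r, h) solved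
by shifted Stirling numbers. -/

/-- The `∗`-height relative to an initial value `h`:
`k_j^* = min (k_j, max {h, k_1^* + 1, …, k_{j-1}^* + 1})`. -/
def starHeightFrom (h : ℕ) {r : ℕ} (k : Fin r → ℕ) (j : Fin r) : ℕ :=
  min (k j) (max h
    (Finset.univ.sup fun i : Fin j.val => starHeightFrom h k ⟨i.val, i.2.trans j.2⟩ + 1))
termination_by j.val
decreasing_by exact i.2

theorem starHeightFrom_le (h : ℕ) {r : ℕ} (k : Fin r → ℕ) (j : Fin r) :
    starHeightFrom h k j ≤ k j := by
  rw [starHeightFrom]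
  exact min_le_left _ _

theorem starHeightFrom_zero_left {r : ℕ} (k : Fin r → ℕ) (j : Fin r) :
    starHeightFrom 0 k j = starHeight k j := by
  rw [starHeightFrom, starHeight, Nat.zero_max]
  congr 2
  funext i
  rw [starHeightFrom_zero_left k ⟨i.val, i.2.trans j.2⟩]
termination_by j.val
decreasing_by exact i.2

/-- The initial value for the columns that follow a first column of height `k`. -/
def nextHeight (h k : ℕ) : ℕ := max h (min k h + 1)

theorem starHeightFrom_zero_right (h : ℕ) {r : ℕ} (k : Fin (r + 1) → ℕ) :
    starHeightFrom h k 0 = min (k 0) h := by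
  rw [starHeightFrom]
  have : (Finset.univ : Finset (Fin (0 : Fin (r + 1)).val)) = ∅ :=
    Finset.univ_eq_empty_iff.mpr (by simpa using Fin.isEmpty)
  rw [this, Finset.sup_empty]
  simp

/-- The first column enters the later maxima only through min(k_0, h) + 1, which `nextHeight` merges
with h. Hence removing it leaves an object of the same kind, with a new initial value. -/
theorem starHeightFrom_succ (h : ℕ) {r : ℕ} (k : Fin (r + 1) → ℕ) (j : Fin r) :
    starHeightFrom h k j.succ = starHeightFrom (nextHeight h (k 0)) (Fin.tail k) j := by
  rw [starHeightFrom, starHeightFrom]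
  have key : max h (Finset.univ.sup fun i : Fin j.succ.val =>
        starHeightFrom h k ⟨i.val, i.2.trans j.succ.2⟩ + 1) =
      max (nextHeight h (k 0)) (Finset.univ.sup fun i : Fin j.val =>
        starHeightFrom (nextHeight h (k 0)) (Fin.tail k) ⟨i.val, i.2.trans j.2⟩ + 1) := by
    have hrec : ∀ i : Fin j.val,
        starHeightFrom h k ⟨i.val + 1, by omega⟩ =
          starHeightFrom (nextHeight h (k 0)) (Fin.tail k) ⟨i.val, i.2.trans j.2⟩ :=
      fun i => starHeightFrom_succ h k ⟨i.val, i.2.trans j.2⟩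
    refine eq_of_forall_ge_iff fun c => ?_
    simp only [max_le_iff, Finset.sup_le_iff, Finset.mem_univ, true_imp_iff, ← hrec]
    rw [nextHeight, max_le_iff]
    constructor
    · rintro ⟨h1, h2⟩
      refine ⟨⟨h1, ?_⟩, fun i => h2 ⟨i.val + 1, by simp⟩⟩
      have := h2 ⟨0, by simp⟩
      rwa [show (⟨(⟨0, by simp⟩ : Fin j.succ.val).val, by simp⟩ : Fin (r + 1)) = 0 from rfl,
        starHeightFrom_zero_right] at this
    · rintro ⟨⟨h1, h2⟩, h3⟩
      refine ⟨h1, ?_⟩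
      rintro ⟨_ | i, hi⟩
      · rw [← starHeightFrom_zero_right] at h2
        exact h2
      · exact h3 ⟨i, by simpa using hi⟩
  rw [key]
  rfl
termination_by j.val
decreasing_by exact i.2

/-- The analogue of `QSetPartition` for `∗`-heights with initial value `h`. -/
structure QSetPartitionFrom (n : ℕ) (F : Type u) (r h : ℕ) where
  k : Fin r → Fin n
  a : (j : Fin r) → Fin ((k j).val - starHeightFrom h (fun i => (k i).val) j) → F

namespace QSetPartitionFrom

variable {n : ℕ} {F : Type u} {r h : ℕ}

theorem ext_val {K K' : QSetPartitionFrom n F r h} (hk : K.k = K'.k)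
    (ha : ∀ j i i', i.val = i'.val → K.a j i = K'.a j i') : K = K' := by
  obtain ⟨k, a⟩ := K
  obtain ⟨k', a'⟩ := K'
  obtain rfl : k = k' := hk
  congr
  funext j i
  exact ha j i i rfl

/-- The partition with first column `(k₀, a₀)` and remaining columns `K`. -/
def cons (k₀ : Fin n) (a₀ : Fin (k₀.val - min k₀.val h) → F)
    (K : QSetPartitionFrom n F r (nextHeight h k₀)) : QSetPartitionFrom n F (r + 1) h where
  k := Fin.cons k₀ K.k
  a := Fin.cases
    (fun i => a₀ (Fin.cast (by rw [starHeightFrom_zero_right]; rfl) i))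
    (fun j i => K.a j (Fin.cast (by rw [starHeightFrom_succ]; rfl) i))

/-- Splitting off the first column. -/
def consMap (n : ℕ) (F : Type u) (r h : ℕ) :
    (Σ i : (Σ k : Fin n, Fin (k.val - min k.val h) → F),
      QSetPartitionFrom n F r (nextHeight h i.1)) → QSetPartitionFrom n F (r + 1) h :=
  fun x => cons x.1.1 x.1.2 x.2

theorem consMap_bijective : Function.Bijective (consMap n F r h) := by
  constructor
  · rintro ⟨⟨k, a⟩, K⟩ ⟨⟨k', a'⟩, K'⟩ hx
    have hk : (Fin.cons k K.k : Fin (r + 1) → Fin n) = Fin.cons k' K'.k :=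
      congrArg QSetPartitionFrom.k hx
    obtain ⟨rfl, hk'⟩ := Fin.cons_injective2 hk
    obtain ⟨K, b⟩ := K
    obtain ⟨K', b'⟩ := K'
    obtain rfl : K = K' := hk'
    have ha := eq_of_heq (QSetPartitionFrom.mk.inj hx).2
    have ha0 : a = a' := by
      funext i
      have := congrFun (congrFun ha 0) (Fin.cast (by rw [starHeightFrom_zero_right]; rfl) i)
      exact this
    have hb : b = b' := by
      funext j i
      have := congrFun (congrFun ha j.succ) (Fin.cast (by rw [starHeightFrom_succ]; rfl) i)
      exact this
    rw [ha0, hb]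
  · intro K
    refine ⟨⟨⟨K.k 0, fun i => K.a 0 (Fin.cast (by rw [starHeightFrom_zero_right]) i)⟩,
      ⟨Fin.tail K.k, fun j i => K.a j.succ (Fin.cast (by rw [starHeightFrom_succ]; rfl) i)⟩⟩, ?_⟩
    refine ext_val (Fin.cons_self_tail _) ?_
    intro j
    refine Fin.cases ?_ (fun j => ?_) j
    · intro i i' hi
      exact congrArg (K.a 0) (Fin.ext hi)
    · intro i i' hi
      exact congrArg (K.a j.succ) (Fin.ext hi)

/-- A partition is its first column followed by the remaining ones. -/
def consEquiv (n : ℕ) (F : Type u) (r h : ℕ) :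
    (Σ i : (Σ k : Fin n, Fin (k.val - min k.val h) → F),
      QSetPartitionFrom n F r (nextHeight h i.1)) ≃ QSetPartitionFrom n F (r + 1) h :=
  Equiv.ofBijective _ consMap_bijective

instance : Unique (QSetPartitionFrom n F 0 h) where
  default := ⟨fun j => j.elim0, fun j => j.elim0⟩
  uniq _ := ext_val (funext fun j => j.elim0) fun j => j.elim0

instance [Finite F] : Finite (QSetPartitionFrom n F r h) :=
  Finite.of_injective
    (fun K => (⟨K.k, K.a⟩ : Σ k : Fin r → Fin n,
      ∀ j, Fin ((k j).val - starHeightFrom h (fun i => (k i).val) j) → F))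
    (by rintro ⟨k, a⟩ ⟨k', a'⟩ hx; simpa using hx)

/-- The element of `ℂG` attached to the column `j` of `K`. -/
def column [Field F] [Fintype F] (K : QSetPartitionFrom n F r h) (j : Fin r) :
    MonoidAlgebra ℂ (GL (Fin n) F) :=
  starW (K.k j) (starHeightFrom h (fun i => (K.k i).val) j)
    (starHeightFrom_le h (fun i => (K.k i).val) j) (K.a j)

end QSetPartitionFrom

theorem starW_congr {n : ℕ} {F : Type u} [Field F] [Fintype F] {k k' : Fin n} {h h' : ℕ}
    (hkk : k = k') (hh : h = h') (hk : h ≤ k.val) (hk' : h' ≤ k'.val)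
    {a : Fin (k.val - h) → F} {a' : Fin (k'.val - h') → F}
    (ha : ∀ i i', i.val = i'.val → a i = a' i') : starW k h hk a = starW k' h' hk' a' := by
  subst hkk hh
  rw [show a = a' from funext fun i => ha i i rfl]

namespace QSetPartitionFrom

variable {n : ℕ} {F : Type u} [Field F] [Fintype F] {r h : ℕ}

theorem column_cons_zero (k₀ : Fin n) (a₀ : Fin (k₀.val - min k₀.val h) → F)
    (K : QSetPartitionFrom n F r (nextHeight h k₀)) :
    (cons k₀ a₀ K).column 0 = starW k₀ (min k₀.val h) (min_le_left _ _) a₀ :=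
  starW_congr rfl (starHeightFrom_zero_right h _) _ _
    fun _ _ hi => congrArg a₀ (Fin.ext hi)

theorem tail_column_cons (k₀ : Fin n) (a₀ : Fin (k₀.val - min k₀.val h) → F)
    (K : QSetPartitionFrom n F r (nextHeight h k₀)) :
    Fin.tail (cons k₀ a₀ K).column = K.column := by
  funext j
  exact starW_congr rfl (starHeightFrom_succ h _ j)
    (starHeightFrom_le h (fun i => ((cons k₀ a₀ K).k i).val) j.succ) _
    fun _ _ hi => congrArg (K.a j) (Fin.ext hi)

/-- For the initial value `0` these are the `q`-set partitions. -/
def equivZero (n : ℕ) (F : Type u) (r : ℕ) : QSetPartitionFrom n F r 0 ≃ QSetPartition n r F where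
  toFun K := ⟨K.k, fun j i => K.a j (Fin.cast (by rw [starHeightFrom_zero_left]) i)⟩
  invFun K := ⟨K.k, fun j i => K.a j (Fin.cast (by rw [starHeightFrom_zero_left]) i)⟩
  left_inv _ := rfl
  right_inv _ := rfl

theorem column_equivZero (K : QSetPartitionFrom n F r 0) :
    (equivZero n F r K).column = K.column := by
  funext j
  exact starW_congr rfl (starHeightFrom_zero_left _ j).symm _ _
    fun _ _ hi => congrArg (K.a j) (Fin.ext hi)

/-- The `q`-set partitions with empty first column. -/
def equivOne (n : ℕ) [NeZero n] (F : Type u) (r : ℕ) :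
    QSetPartitionFrom n F r 1 ≃ {K : QSetPartition n (r + 1) F // K.k 0 = 0} :=
  Equiv.ofBijective
    -- A first column of height 0 carries no label, and `nextHeight 0 0 = 1`.
    (fun K => ⟨equivZero n F (r + 1) (cons (h := 0) 0 (fun i => i.elim0) K), rfl⟩) (by
      constructor
      · intro K K' hK
        have h1 := (equivZero n F (r + 1)).injective (Subtype.ext_iff.mp hK)
        exact eq_of_heq (Sigma.mk.inj ((consMap_bijective (h := 0)).injective
          (a₁ := ⟨⟨0, fun i => absurd i.2 (by simp)⟩, K⟩)
          (a₂ := ⟨⟨0, fun i => absurd i.2 (by simp)⟩, K'⟩) h1)).2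
      · rintro ⟨K, hK⟩
        obtain ⟨K, rfl⟩ := (equivZero n F (r + 1)).surjective K
        obtain ⟨⟨⟨k, a⟩, K⟩, rfl⟩ := consMap_bijective.surjective K
        obtain rfl : k = 0 := hK
        obtain rfl : a = fun i => i.elim0 := funext fun i => i.elim0
        exact ⟨K, rfl⟩)

theorem column_equivOne [NeZero n] (K : QSetPartitionFrom n F r 1) :
    Fin.tail (equivOne n F r K).val.column = K.column := by
  change Fin.tail (equivZero n F (r + 1) (cons (h := 0) 0 (fun i => i.elim0) K)).column = _
  rw [column_equivZero]
  exact tail_column_cons (h := 0) 0 _ K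

end QSetPartitionFrom

theorem column_zero_of_empty {n : ℕ} [NeZero n] {F : Type u} [Field F] [Fintype F] {r : ℕ}
    (K : QSetPartition n (r + 1) F) (hK : K.k 0 = 0) : K.column 0 = 1 := by
  have h0 : starHeight (fun i => (K.k i).val) 0 = 0 := by
    have := starHeight_le (fun i => (K.k i).val) 0
    simpa [hK] using this
  have : K.column 0 = starW (0 : Fin n) 0 le_rfl (fun i => i.elim0) :=
    starW_congr hK h0 _ _ fun _ i' => i'.elim0
  rw [this]
  simp [starW, sProd, MonoidAlgebra.one_def]

/-! ### Counting -/

/-- The numbers defined by `S_h(r + 1, l) = h S_h(r, l) + S_{h+1}(r, l - 1)`; for `h = 0` these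
are the Stirling numbers of the second kind. -/
def shiftedStirling : ℕ → ℕ → ℕ → ℕ
  | _, 0, 0 => 1
  | _, 0, _ + 1 => 0
  | h, r + 1, 0 => h * shiftedStirling h r 0
  | h, r + 1, l + 1 => h * shiftedStirling h r (l + 1) + shiftedStirling (h + 1) r l

/-- S_h(r, l) is the complete homogeneous symmetric polynomial of degree r - l in h, h+1, …, h+l.
The defining recursion splits off the variable h, this one the last variable; at h = 0 it is the
recursion of the Stirling numbers. -/
theorem shiftedStirling_succ_succ (r : ℕ) : ∀ h l, shiftedStirling h (r + 1) (l + 1) =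
    (h + l + 1) * shiftedStirling h r (l + 1) + shiftedStirling h r l := by
  induction r with
  | zero => intro h l; cases l <;> simp [shiftedStirling]
  | succ r ih =>
    intro h l
    have h1 : shiftedStirling h (r + 1) (l + 1) =
      h * shiftedStirling h r (l + 1) + shiftedStirling (h + 1) r l := rfl
    have h2 : shiftedStirling h (r + 1 + 1) (l + 1) =
      h * shiftedStirling h (r + 1) (l + 1) + shiftedStirling (h + 1) (r + 1) l := rfl
    cases l with
    | zero =>
      have h3 : shiftedStirling (h + 1) (r + 1) 0 = (h + 1) * shiftedStirling (h + 1) r 0 := rfl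
      have h4 : shiftedStirling h (r + 1) 0 = h * shiftedStirling h r 0 := rfl
      linear_combination h2 + h3 - h4 + h * ih h 0 - (h + 1) * h1
    | succ l =>
      have h3 : shiftedStirling h (r + 1) (l + 1) =
        h * shiftedStirling h r (l + 1) + shiftedStirling (h + 1) r l := rfl
      linear_combination h2 + ih (h + 1) l - h3 + h * ih h (l + 1) - (h + l + 2) * h1

theorem shiftedStirling_zero (r : ℕ) : ∀ l, shiftedStirling 0 r l = Nat.stirlingSecond r l := by
  induction r with
  | zero => intro l; cases l <;> rfl
  | succ r ih =>
    intro l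
    cases l with
    | zero => simp [shiftedStirling]
    | succ l =>
      rw [shiftedStirling_succ_succ, ih, ih, Nat.stirlingSecond_succ_succ, Nat.zero_add]

/-- A first column with k < h has no labels and keeps h, which gives h choices. One with k ≥ h has
q^(k-h) labelings and raises h to h + 1; the sum over k is [n-h]. -/
theorem card_qSetPartitionFrom_succ (n : ℕ) (F : Type u) [Fintype F] (r : ℕ) {h : ℕ}
    (hn : h ≤ n) :
    Nat.card (QSetPartitionFrom n F (r + 1) h) =
      h * Nat.card (QSetPartitionFrom n F r h) +
        qInt (Fintype.card F) (n - h) * Nat.card (QSetPartitionFrom n F r (h + 1)) := by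
  rw [← Nat.card_congr (QSetPartitionFrom.consEquiv n F r h), Nat.card_sigma, ← Finset.univ_sigma_univ,
    Finset.sum_sigma]
  have : ∀ k : Fin n, ∑ _a : Fin (k.val - min k.val h) → F,
      Nat.card (QSetPartitionFrom n F r (nextHeight h k)) =
      Fintype.card F ^ (k.val - min k.val h) *
        Nat.card (QSetPartitionFrom n F r (nextHeight h k)) := by
    intro k
    simp
  simp only [this]
  rw [Fin.sum_univ_eq_sum_range (fun k => Fintype.card F ^ (k - min k h) *
        Nat.card (QSetPartitionFrom n F r (nextHeight h k))),
    ← Finset.sum_range_add_sum_Ico _ hn, Finset.sum_Ico_eq_sum_range, qInt, Finset.sum_mul]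
  congr 1
  · rw [Finset.sum_congr rfl (g := fun _ => Nat.card (QSetPartitionFrom n F r h))]
    · simp
    · intro k hk
      have hk := Finset.mem_range.mp hk
      rw [show k - min k h = 0 by omega, show nextHeight h k = h by unfold nextHeight; omega]
      simp
  · refine Finset.sum_congr rfl fun k _ => ?_
    rw [show h + k - min (h + k) h = k by omega,
      show nextHeight h (h + k) = h + 1 by unfold nextHeight; omega]

theorem card_qSetPartitionFrom (n : ℕ) (F : Type u) [Fintype F] (r : ℕ) :
    ∀ {h : ℕ}, h ≤ n → Nat.card (QSetPartitionFrom n F r h) =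
      ∑ l ∈ Finset.range (n - h + 1),
        shiftedStirling h r l * ∏ i ∈ Finset.range l, qInt (Fintype.card F) (n - h - i) := by
  induction r with
  | zero =>
    intro h _
    rw [Finset.sum_range_succ']
    simp [shiftedStirling]
  | succ r ih =>
    intro h hn
    rw [card_qSetPartitionFrom_succ n F r hn, ih hn]
    -- For h = n the hypothesis at h + 1 is not available, but its coefficient is [0] = 0.
    obtain rfl | hlt := hn.eq_or_lt
    · simp [qInt, shiftedStirling]
    · rw [ih hlt, show n - h.succ + 1 = n - h by omega, Finset.sum_range_succ',
        Finset.sum_range_succ', mul_add, Finset.mul_sum, Finset.mul_sum, add_right_comm,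
        ← Finset.sum_add_distrib, shiftedStirling]
      congr 1
      · refine Finset.sum_congr rfl fun l _ => ?_
        rw [shiftedStirling, Finset.prod_range_succ',
          Finset.prod_congr rfl
            (f := fun i => qInt (Fintype.card F) (n - h.succ - i))
            (g := fun i => qInt (Fintype.card F) (n - h - (i + 1)))
            (fun i _ => by rw [show n - h.succ - i = n - h - (i + 1) by omega])]
        simp only [Nat.sub_zero, Nat.succ_eq_add_one]
        ring
      · simp

theorem card_qSetPartitionFrom_zero (n : ℕ) (F : Type u) [Fintype F] (r : ℕ) :
    Nat.card (QSetPartitionFrom n F r 0) = d n r (Fintype.card F) := by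
  rw [card_qSetPartitionFrom n F r (Nat.zero_le n), d]
  simp only [shiftedStirling_zero, Nat.sub_zero]

theorem qInt_mul_card_qSetPartitionFrom_one (n : ℕ) (F : Type u) [Fintype F] (r : ℕ) :
    qInt (Fintype.card F) n * Nat.card (QSetPartitionFrom n F r 1) =
      d n (r + 1) (Fintype.card F) := by
  rw [← card_qSetPartitionFrom_zero, card_qSetPartitionFrom_succ n F r (Nat.zero_le n)]
  simp

theorem qInt_pos (q : ℕ) {n : ℕ} (hn : n ≠ 0) : 0 < qInt q n := by
  obtain ⟨m, rfl⟩ := Nat.exists_eq_succ_of_ne_zero hn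
  rw [qInt, Finset.sum_range_succ']
  simp

/-! ### Averages over finite subgroups -/

section Average

variable {G : Type*} [Group G] {V : Type*} [AddCommGroup V] [Module ℂ V]

/-- The operator by which the idempotent of the finite subgroup `H` acts. -/
def avg (ρ : Representation ℂ G V) (H : Subgroup G) [Fintype H] : V →ₗ[ℂ] V :=
  (Fintype.card H : ℂ)⁻¹ • ∑ u : H, ρ u.val

variable (ρ : Representation ℂ G V) (H : Subgroup G) [Fintype H]

theorem avg_apply (v : V) : avg ρ H v = (Fintype.card H : ℂ)⁻¹ • ∑ u : H, ρ u.val v := by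
  simp [avg]

theorem avg_map {u : G} (hu : u ∈ H) (v : V) : avg ρ H (ρ u v) = avg ρ H v := by
  rw [avg_apply, avg_apply]
  congr 1
  refine Fintype.sum_equiv (Equiv.mulRight (⟨u, hu⟩ : H)) _ _ fun w => ?_
  simp

theorem map_avg {u : G} (hu : u ∈ H) (v : V) : ρ u (avg ρ H v) = avg ρ H v := by
  rw [avg_apply, map_smul, map_sum]
  congr 1
  refine Fintype.sum_equiv (Equiv.mulLeft (⟨u, hu⟩ : H)) _ _ fun w => ?_
  simp

theorem sum_inv_card_smul {ι : Type*} [Fintype ι] [Nonempty ι] (v : V) :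
    (Fintype.card ι : ℂ)⁻¹ • ∑ _i : ι, v = v := by
  rw [Finset.sum_const, Finset.card_univ, ← Nat.cast_smul_eq_nsmul ℂ, smul_smul,
    inv_mul_cancel₀ (Nat.cast_ne_zero.mpr Fintype.card_ne_zero), one_smul]

theorem avg_eq_self {v : V} (hv : ∀ u ∈ H, ρ u v = v) : avg ρ H v = v := by
  rw [avg_apply, Finset.sum_congr rfl fun u _ => hv u.val u.2, sum_inv_card_smul]

/-- A linear map that is constant on the `H`-orbit of `v` does not distinguish `v` from its
average. -/
theorem apply_avg_eq {W : Type*} [AddCommGroup W] [Module ℂ W] (f : V →ₗ[ℂ] W) {v : V}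
    (hf : ∀ u ∈ H, f (ρ u v) = f v) : f (avg ρ H v) = f v := by
  rw [avg_apply, map_smul, map_sum, Finset.sum_congr rfl fun u _ => hf u.val u.2,
    sum_inv_card_smul]

end Average

/-! ### Harish-Chandra restriction and induction -/

section HarishChandra

variable {n : ℕ} [NeZero n] {F : Type u} [Field F]

theorem levi_le_parabolic : levi n F ≤ parabolic n F := fun l hl i hi =>
  hl i 0 (by simp [hi])

theorem toLevi_of_mem_levi (l : levi n F) :
    toLevi n F ⟨l.val, levi_le_parabolic l.2⟩ = l := by
  refine Subtype.ext (Units.ext (Matrix.ext fun i j => ?_))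
  change (if (i = 0 ↔ j = 0) then l.val.val i j else 0) = l.val.val i j
  split_ifs with h
  · rfl
  · exact (l.2 i j h).symm

/-- The unipotent factor of an element of `P = LU` lies in `U`. -/
theorem toLevi_inv_mul_mem_unip (p : parabolic n F) :
    (toLevi n F p).val⁻¹ * p.val ∈ unip n F := by
  have hl : toLevi n F (⟨(toLevi n F p).val, levi_le_parabolic (toLevi n F p).2⟩⁻¹ * p) = 1 := by
    rw [map_mul, map_inv, toLevi_of_mem_levi, inv_mul_cancel]
  set x : parabolic n F := ⟨(toLevi n F p).val, levi_le_parabolic (toLevi n F p).2⟩⁻¹ * p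
  have hx : ∀ i j, (if (i = 0 ↔ j = 0) then x.val.val i j else 0) =
      (1 : Matrix (Fin n) (Fin n) F) i j :=
    fun i j => congrFun (congrFun (congrArg (fun y => y.val.val) hl) i) j
  have hrow : ∀ i j : Fin n, i ≠ 0 → x.val.val i j = (1 : Matrix (Fin n) (Fin n) F) i j := by
    intro i j hi
    by_cases hj : j = 0
    · subst hj
      rw [x.2 i hi, Matrix.one_apply_ne hi]
    · simpa [hi, hj] using hx i j
  intro i j hij
  change x.val.val i j = _
  by_cases hi : i = 0
  · have hj : j = 0 := hij.resolve_left (by simp [hi])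
    subst hi hj
    simpa using hx 0 0
  · exact hrow i j hi

open scoped Classical in
/-- The action on `V` of the `L`-component of `x` if `x ∈ P`, and `0` otherwise. -/
def leviPart (V : Rep.{u} ℂ (levi n F)) (x : GL (Fin n) F) : V →ₗ[ℂ] V :=
  if h : x ∈ parabolic n F then V.ρ (toLevi n F ⟨x, h⟩) else 0

theorem leviPart_of_mem (V : Rep.{u} ℂ (levi n F)) (p : parabolic n F) :
    leviPart V p.val = V.ρ (toLevi n F p) := dif_pos p.2

theorem leviPart_of_notMem (V : Rep.{u} ℂ (levi n F)) {x : GL (Fin n) F}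
    (hx : x ∉ parabolic n F) : leviPart V x = 0 := dif_neg hx

/-- The balancing relation over P; it makes `cosetCoeff` well defined on the coinvariants. -/
theorem leviPart_mul_inv (V : Rep.{u} ℂ (levi n F)) (x : GL (Fin n) F) (p : parabolic n F)
    (v : V) : leviPart V (x * p.val⁻¹) (V.ρ (toLevi n F p) v) = leviPart V x v := by
  by_cases h : x ∈ parabolic n F
  · lift x to parabolic n F using h
    rw [← Subgroup.coe_inv, ← Subgroup.coe_mul, leviPart_of_mem, leviPart_of_mem,
      ← Module.End.mul_apply, ← map_mul, ← map_mul, inv_mul_cancel_right]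
  · rw [leviPart_of_notMem V h, leviPart_of_notMem V (x := x * p.val⁻¹) fun hm =>
      h (((parabolic n F).mul_mem_cancel_right (p⁻¹).2).mp hm)]
    rfl

/-- The coefficient of `g ⊗ -` in an element of `Indf V`. -/
def cosetCoeff (V : Rep.{u} ℂ (levi n F)) (g : GL (Fin n) F) : Indf V →ₗ[ℂ] V :=
  Representation.Coinvariants.lift _
    (TensorProduct.lift ((Finsupp.linearCombination ℂ fun y : GL (Fin n) F =>
      leviPart V (g⁻¹ * y⁻¹)) ∘ₗ (MonoidAlgebra.coeffLinearEquiv ℂ).toLinearMap)) (by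
    intro p
    ext y v
    simp only [TensorProduct.AlgebraTensorModule.curry_apply, LinearMap.restrictScalars_self,
      TensorProduct.curry_apply, LinearMap.coe_comp, Function.comp_apply,
      Representation.tprod_apply, TensorProduct.map_tmul, TensorProduct.lift.tmul,
      MonoidHom.coe_comp, Subgroup.coe_subtype, Representation.leftRegular,
      Representation.ofMulAction_single, MonoidAlgebra.coeffLinearEquiv_apply,
      MonoidAlgebra.lsingle_apply, LinearEquiv.coe_coe, MonoidAlgebra.coeff_single, smul_eq_mul]
    have h : ∀ (x : GL (Fin n) F) (w : V), (Finsupp.linearCombination ℂ fun y : GL (Fin n) F =>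
        leviPart V (g⁻¹ * y⁻¹)) (Finsupp.single x 1) w = leviPart V (g⁻¹ * x⁻¹) w := fun x w => by
      rw [Finsupp.linearCombination_single, one_smul]
    refine (h _ _).trans (Eq.trans ?_ (h y v).symm)
    rw [mul_inv_rev, ← mul_assoc]
    exact leviPart_mul_inv V (g⁻¹ * y⁻¹) p v)

theorem cosetCoeff_groupTmul (V : Rep.{u} ℂ (levi n F)) (g x : GL (Fin n) F) (v : V) :
    cosetCoeff V g (groupTmul V x v) = leviPart V (g⁻¹ * x) v := by
  have : cosetCoeff V g (groupTmul V x v) = (Finsupp.linearCombination ℂ fun y : GL (Fin n) F =>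
      leviPart V (g⁻¹ * y⁻¹)) (Finsupp.single x⁻¹ 1) v := rfl
  rw [this, Finsupp.linearCombination_single, one_smul, inv_inv]

theorem groupTmul_one_injective (V : Rep.{u} ℂ (levi n F)) :
    Function.Injective (groupTmul V 1) := by
  refine Function.LeftInverse.injective (g := cosetCoeff V 1) fun v => ?_
  rw [cosetCoeff_groupTmul, inv_one, one_mul]
  refine (LinearMap.congr_fun (leviPart_of_mem V 1) v).trans ?_
  rw [map_one, map_one, Module.End.one_apply]

theorem span_groupTmul (V : Rep.{u} ℂ (levi n F)) (S : Submodule ℂ (Indf V))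
    (hS : ∀ g v, groupTmul V g v ∈ S) (w : Indf V) : w ∈ S := by
  have : S.mkQ = 0 := Representation.IndV.hom_ext _ _ fun g => by
    ext v
    have := hS g⁻¹ v
    rw [groupTmul, inv_inv] at this
    exact (Submodule.Quotient.mk_eq_zero S).mpr this
  exact (Submodule.Quotient.mk_eq_zero S).mp (LinearMap.congr_fun this w)

variable [Fintype F]

theorem eUOp_eq_avg (V : Rep.{u} ℂ (GL (Fin n) F)) : eUOp V = avg V.ρ (unip n F) := by
  simp [eUOp, eU, avg]

theorem toResf_val (V : Rep.{u} ℂ (GL (Fin n) F)) (v : V) :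
    (toResf V v).val = avg V.ρ (unip n F) v := by
  rw [← eUOp_eq_avg]
  rfl

theorem resf_val_fixed (V : Rep.{u} ℂ (GL (Fin n) F)) (y : Resf V) {u : GL (Fin n) F}
    (hu : u ∈ unip n F) : V.ρ u y.val = y.val := by
  obtain ⟨v, rfl⟩ := LinearMap.surjective_rangeRestrict (eUOp V) y
  exact (congrArg (V.ρ u) (toResf_val V v)).trans
    ((map_avg V.ρ _ hu v).trans (toResf_val V v).symm)

theorem resf_smul_val (V : Rep.{u} ℂ (GL (Fin n) F)) (l : levi n F) (y : Resf V) :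
    ((Resf V).ρ l y).val = V.ρ l.val y.val := rfl

/-- Write p = lu with l in L and u in U. Since u fixes e_U V, the inflated action on e_U V is the
restriction of the action of P on V. -/
theorem resf_smul_toLevi_val (V : Rep.{u} ℂ (GL (Fin n) F)) (p : parabolic n F) (y : Resf V) :
    ((Resf V).ρ (toLevi n F p) y).val = V.ρ p.val y.val := by
  rw [resf_smul_val]
  conv_rhs => rw [show p.val = (toLevi n F p).val * ((toLevi n F p).val⁻¹ * p.val) by group,
    map_mul, Module.End.mul_apply, resf_val_fixed V y (toLevi_inv_mul_mem_unip p)]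

theorem toResf_levi (V : Rep.{u} ℂ (GL (Fin n) F)) (l : levi n F) (v : V) :
    toResf V (V.ρ l.val v) = (Resf V).ρ l (toResf V v) :=
  Subtype.ext (eUOp_comm V l v).symm

/-- Again p = lu: e_U commutes with l and absorbs u. -/
theorem toResf_parabolic (V : Rep.{u} ℂ (GL (Fin n) F)) (p : parabolic n F) (v : V) :
    toResf V (V.ρ p.val v) = (Resf V).ρ (toLevi n F p) (toResf V v) := by
  rw [← toResf_levi]
  set l := (toLevi n F p).val with hl
  rw [show p.val = l * (l⁻¹ * p.val) by group, map_mul, Module.End.mul_apply]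
  set u := l⁻¹ * p.val
  have hu : u ∈ unip n F := toLevi_inv_mul_mem_unip p
  rw [hl, toResf_levi, toResf_levi]
  congr 1
  refine Subtype.ext ?_
  rw [toResf_val, toResf_val, avg_map _ _ hu]

theorem avg_groupTmul_mul (V : Rep.{u} ℂ (levi n F)) (H : Subgroup (GL (Fin n) F)) [Fintype H]
    {u : GL (Fin n) F} (hu : u ∈ H) (g : GL (Fin n) F) (v : V) :
    avg (Indf V).ρ H (groupTmul V (u * g) v) = avg (Indf V).ρ H (groupTmul V g v) := by
  rw [← smul_groupTmul, avg_map _ _ hu]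

/-- The stabilizer of `gP` in `H` acts trivially on `g ⊗ v` up to averaging over `H`. -/
theorem avg_groupTmul_stabilizer (V : Rep.{u} ℂ (levi n F)) (H : Subgroup (GL (Fin n) F))
    [Fintype H] (g : GL (Fin n) F) (p : parabolic n F) (hp : g * p.val * g⁻¹ ∈ H) (v : V) :
    avg (Indf V).ρ H (groupTmul V g (V.ρ (toLevi n F p) v)) =
      avg (Indf V).ρ H (groupTmul V g v) := by
  rw [← groupTmul_mul, show g * p.val = g * p.val * g⁻¹ * g by group, avg_groupTmul_mul _ _ hp]

open scoped Classical in
-- The constant is the proportion of u in H with ugP = gP, which is positive because u = 1 counts.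
-- It does not depend on v, so a whole linear relation can be tested at once.
theorem cosetCoeff_avg_groupTmul_self (V : Rep.{u} ℂ (levi n F)) (H : Subgroup (GL (Fin n) F))
    [Fintype H] (g : GL (Fin n) F) : ∃ c : ℂ, c ≠ 0 ∧ ∀ v : V,
      (∀ p : parabolic n F, g * p.val * g⁻¹ ∈ H → V.ρ (toLevi n F p) v = v) →
      cosetCoeff V g (avg (Indf V).ρ H (groupTmul V g v)) = c • v := by
  refine ⟨(Fintype.card H : ℂ)⁻¹ *
    (Finset.univ.filter fun u : H => g⁻¹ * (u.val * g) ∈ parabolic n F).card, ?_, ?_⟩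
  · refine mul_ne_zero (inv_ne_zero (Nat.cast_ne_zero.mpr Fintype.card_ne_zero))
      (Nat.cast_ne_zero.mpr (Finset.card_pos.mpr ⟨1, ?_⟩).ne')
    simp [one_mem]
  · intro v hv
    rw [avg_apply, map_smul, map_sum, mul_smul]
    congr 1
    rw [Finset.sum_congr rfl (g := fun u : H =>
      if g⁻¹ * (u.val * g) ∈ parabolic n F then v else 0)]
    · rw [← Finset.sum_filter, Finset.sum_const, Nat.cast_smul_eq_nsmul]
    · intro u _
      rw [smul_groupTmul, cosetCoeff_groupTmul]
      split_ifs with h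
      · refine (LinearMap.congr_fun (leviPart_of_mem V ⟨_, h⟩) v).trans (hv _ ?_)
        simp [mul_assoc]
      · rw [leviPart_of_notMem V h]
        rfl

theorem cosetCoeff_avg_groupTmul_of_ne (V : Rep.{u} ℂ (levi n F)) (H : Subgroup (GL (Fin n) F))
    [Fintype H] {g g' : GL (Fin n) F} (hg : ∀ u ∈ H, g⁻¹ * (u * g') ∉ parabolic n F) (v : V) :
    cosetCoeff V g (avg (Indf V).ρ H (groupTmul V g' v)) = 0 := by
  rw [avg_apply, map_smul, map_sum, Finset.sum_eq_zero, smul_zero]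
  intro u _
  rw [smul_groupTmul, cosetCoeff_groupTmul, leviPart_of_notMem V (hg u.val u.2)]
  rfl

/-! ### Fixed vectors of an induced module via double cosets -/

section Mackey

variable (V : Rep.{u} ℂ (levi n F)) (H : Subgroup (GL (Fin n) F)) [Fintype H]
  {I : Type*} (g : I → GL (Fin n) F) {J : I → Type*} (b : ∀ i, J i → V)

/-- For `H \ G / P` represented by `g`, linearly independent families of stabilizer-fixed vectors
of `V` give a linearly independent family of `H`-fixed vectors of `Indf V`. -/
theorem linearIndependent_avg_groupTmul [Fintype I] [∀ i, Fintype (J i)]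
    (hdisj : ∀ i j, ∀ u ∈ H, (g i)⁻¹ * (u * g j) ∈ parabolic n F → i = j)
    (hfix : ∀ i j, ∀ p : parabolic n F, g i * p.val * (g i)⁻¹ ∈ H →
      V.ρ (toLevi n F p) (b i j) = b i j)
    (hb : ∀ i, LinearIndependent ℂ (b i)) :
    LinearIndependent ℂ fun x : Σ i, J i =>
      avg (Indf V).ρ H (groupTmul V (g x.1) (b x.1 x.2)) := by
  rw [Fintype.linearIndependent_iff]
  rintro c hc ⟨i, j⟩
  obtain ⟨t, ht, hcoeff⟩ := cosetCoeff_avg_groupTmul_self V H (g i)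
  -- The coefficient at g_i kills the terms of all other double cosets and leaves t times a relation
  -- among the b_i.
  have h := congrArg (cosetCoeff V (g i)) hc
  rw [map_zero, map_sum, ← Finset.univ_sigma_univ, Finset.sum_sigma,
    Finset.sum_eq_single i] at h
  · have h2 : ∑ j, (c ⟨i, j⟩ * t) • b i j = 0 := by
      rw [← h]
      refine Finset.sum_congr rfl fun j _ => ?_
      rw [map_smul, hcoeff _ (hfix i j), smul_smul]
    have := Fintype.linearIndependent_iff.mp (hb i) _ h2 j
    exact (mul_eq_zero.mp this).resolve_right ht
  · intro i' _ hi
    refine Finset.sum_eq_zero fun j _ => ?_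
    rw [map_smul, cosetCoeff_avg_groupTmul_of_ne, smul_zero]
    exact fun u hu hm => hi (hdisj i i' u hu hm).symm
  · simp

/-- For `H \ G / P` represented by `g`, families that span the stabilizer-fixed vectors of `V`
give a family that spans the `H`-fixed vectors of `Indf V`. -/
theorem avg_mem_span_groupTmul
    (hcover : ∀ x, ∃ i, ∃ u ∈ H, ∃ p : parabolic n F, x = u * (g i * p.val))
    (hspan : ∀ i v, (∀ p : parabolic n F, g i * p.val * (g i)⁻¹ ∈ H →
      V.ρ (toLevi n F p) v = v) → v ∈ Submodule.span ℂ (Set.range (b i)))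
    (w : Indf V) :
    avg (Indf V).ρ H w ∈ Submodule.span ℂ (Set.range fun x : Σ i, J i =>
      avg (Indf V).ρ H (groupTmul V (g x.1) (b x.1 x.2))) := by
  refine span_groupTmul V (Submodule.comap (avg (Indf V).ρ H)
    (Submodule.span ℂ (Set.range fun x : Σ i, J i =>
      avg (Indf V).ρ H (groupTmul V (g x.1) (b x.1 x.2))))) (fun x v => ?_) w
  obtain ⟨i, u, hu, p, rfl⟩ := hcover x
  rw [Submodule.mem_comap, avg_groupTmul_mul _ _ hu, groupTmul_mul]
  set v' := V.ρ (toLevi n F p) v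
  -- S is the stabilizer of g_i P in H, conjugated into P. Averaging v' over S does not change its
  -- image under f and makes it S-fixed, so `hspan` applies.
  let S : Subgroup (parabolic n F) :=
    H.comap ((MulAut.conj (g i)).toMonoidHom.comp (parabolic n F).subtype)
  let _ : Fintype S := Fintype.ofFinite _
  let f := (avg (Indf V).ρ H) ∘ₗ groupTmul V (g i)
  have h1 : f (avg (Infl V).ρ S v') = f v' :=
    apply_avg_eq (Infl V).ρ S f fun s hs => avg_groupTmul_stabilizer V H (g i) s hs v'
  change f v' ∈ _
  rw [← h1]
  have h2 := hspan i (avg (Infl V).ρ S v') fun s hs => map_avg (Infl V).ρ S hs v'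
  have h3 := Submodule.mem_map_of_mem (f := f) h2
  rw [Submodule.map_span] at h3
  refine Submodule.span_mono ?_ h3
  rintro _ ⟨_, ⟨j, rfl⟩, rfl⟩
  exact ⟨⟨i, j⟩, rfl⟩

end Mackey

end HarishChandra

/-! ### The unipotent radicals `U_h` of the parabolic subgroups of type `(1, …, 1, n - h)` -/

section Unipotent

variable {n : ℕ} {F : Type u} [Field F]

/-- Strictly upper triangular matrices whose nonzero entries lie in the first `h` rows. -/
def IsStrictUpper (h : ℕ) (N : Matrix (Fin n) (Fin n) F) : Prop :=
  ∀ i j : Fin n, ¬ (i < j ∧ i.val < h) → N i j = 0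

/-- Upper triangular matrices. -/
def IsUpper (T : Matrix (Fin n) (Fin n) F) : Prop := ∀ i j : Fin n, j < i → T i j = 0

/-- An upper triangular left factor brings into row i only rows with index at least i, so the
support stays in place. With the right-hand version this makes U_h a group normalized by all U_{h'}.
-/
theorem IsStrictUpper.upper_mul {h : ℕ} {T N : Matrix (Fin n) (Fin n) F} (hN : IsStrictUpper h N)
    (hT : IsUpper T) : IsStrictUpper h (T * N) := by
  intro i j hij
  rw [Matrix.mul_apply]
  refine Finset.sum_eq_zero fun m _ => ?_
  by_cases hm : m < i
  · rw [hT i m hm, zero_mul]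
  · rw [hN m j (by simp only [Fin.lt_def] at *; omega), mul_zero]

theorem IsStrictUpper.mul_upper {h : ℕ} {T N : Matrix (Fin n) (Fin n) F} (hN : IsStrictUpper h N)
    (hT : IsUpper T) : IsStrictUpper h (N * T) := by
  intro i j hij
  rw [Matrix.mul_apply]
  refine Finset.sum_eq_zero fun m _ => ?_
  by_cases hm : j < m
  · rw [hT m j hm, mul_zero]
  · rw [hN i m (by simp only [Fin.lt_def] at *; omega), zero_mul]

theorem isUpper_of_sub_one {h : ℕ} {M : Matrix (Fin n) (Fin n) F}
    (hM : IsStrictUpper h (M - 1)) : IsUpper M := by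
  intro i j hij
  have := hM i j fun h => absurd h.1 hij.not_gt
  rwa [Matrix.sub_apply, Matrix.one_apply_ne hij.ne', sub_zero] at this

theorem IsUpper.inv {g : GL (Fin n) F} (hg : IsUpper g.val) : IsUpper g⁻¹.val := by
  have hb : Matrix.BlockTriangular g.val id := fun i j hij => hg i j hij
  let _ : Invertible g.val := g.invertible
  intro i j hij
  rw [Matrix.coe_units_inv]
  exact Matrix.blockTriangular_inv_of_blockTriangular hb hij

variable (n F) in
/-- The group of the matrices `1 + N`, where `N` is strictly upper triangular with nonzero entries
in the first `h` rows only. -/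
def unipFrom (h : ℕ) : Subgroup (GL (Fin n) F) where
  carrier := {g | IsStrictUpper h (g.val - 1)}
  one_mem' := fun i j _ => by simp
  mul_mem' := by
    intro a b ha hb i j hij
    have : (a * b).val - 1 = a.val * (b.val - 1) + (a.val - 1) := by
      rw [Units.val_mul, mul_sub, mul_one, sub_add_sub_cancel]
    rw [this, Matrix.add_apply, hb.upper_mul (isUpper_of_sub_one ha) i j hij, ha i j hij, add_zero]
  inv_mem' := by
    intro g hg i j hij
    have : g⁻¹.val - 1 = -(g⁻¹.val * (g.val - 1)) := by
      rw [mul_sub, mul_one, ← Units.val_mul, inv_mul_cancel, Units.val_one, neg_sub]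
    rw [this, Matrix.neg_apply, IsStrictUpper.upper_mul hg (isUpper_of_sub_one hg).inv i j hij,
      neg_zero]

theorem mem_unipFrom {h : ℕ} {g : GL (Fin n) F} :
    g ∈ unipFrom n F h ↔ ∀ i j : Fin n, ¬ (i < j ∧ i.val < h) →
      g.val i j = (1 : Matrix (Fin n) (Fin n) F) i j :=
  forall₃_congr fun i j _ => by rw [Matrix.sub_apply, sub_eq_zero]

theorem unipFrom_zero : unipFrom n F 0 = ⊥ := by
  refine (Subgroup.eq_bot_iff_forall _).mpr fun g hg => Units.ext (Matrix.ext fun i j => ?_)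
  exact mem_unipFrom.mp hg i j (by simp)

theorem unipFrom_one [NeZero n] : unipFrom n F 1 = unip n F := by
  ext g
  rw [mem_unipFrom]
  change _ ↔ ∀ i j, (i ≠ 0 ∨ j = 0) → _
  refine forall₂_congr fun i j => imp_congr_left ?_
  simp only [Fin.lt_def, Ne, Fin.ext_iff, Fin.val_zero]
  omega

theorem unipFrom_mono {h h' : ℕ} (hh : h ≤ h') : unipFrom n F h ≤ unipFrom n F h' :=
  fun _ hg i j hij => hg i j fun hlt => hij ⟨hlt.1, hlt.2.trans_le hh⟩

theorem unipFrom_le_parabolic [NeZero n] (h : ℕ) : unipFrom n F h ≤ parabolic n F := by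
  intro g hg i hi
  rw [mem_unipFrom.mp hg i 0 (by simp), Matrix.one_apply_ne hi]

/-- The group `U_h` is normalized by the unitriangular matrices. -/
theorem conj_mem_unipFrom {h h' : ℕ} {t : GL (Fin n) F} (ht : t ∈ unipFrom n F h')
    {g : GL (Fin n) F} (hg : g ∈ unipFrom n F h) : t * g * t⁻¹ ∈ unipFrom n F h := by
  have : (t * g * t⁻¹).val - 1 = t.val * (g.val - 1) * t⁻¹.val := by
    rw [mul_sub, mul_one, sub_mul, ← Units.val_mul, ← Units.val_mul, ← Units.val_mul,
      mul_inv_cancel, Units.val_one]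
  change IsStrictUpper h _
  rw [this]
  exact (IsStrictUpper.upper_mul hg (isUpper_of_sub_one ht)).mul_upper (isUpper_of_sub_one ht).inv

theorem conj_mem_unipFrom_iff {h h' : ℕ} {t : GL (Fin n) F} (ht : t ∈ unipFrom n F h')
    {g : GL (Fin n) F} : t * g * t⁻¹ ∈ unipFrom n F h ↔ g ∈ unipFrom n F h := by
  refine ⟨fun hg => ?_, conj_mem_unipFrom ht⟩
  have := conj_mem_unipFrom (inv_mem ht) hg
  rwa [show t⁻¹ * (t * g * t⁻¹) * t⁻¹⁻¹ = g by group] at this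

instance [Fintype F] (h : ℕ) : Fintype (unipFrom n F h) := Fintype.ofFinite _

end Unipotent

/-! ### The matrices `s_k(c_k) ⋯ s_1(c_1)` -/

section Columns

variable {n : ℕ} {F : Type u} [Field F]

variable (n) in
/-- The matrix with first column `(c_0, …, c_{k-1}, 1, 0, …, 0)` whose columns `1, …, k` are
`e_0, …, e_{k-1}` and whose remaining columns are those of the identity matrix. -/
def colMat (k : ℕ) (c : ℕ → F) : Matrix (Fin n) (Fin n) F :=
  Matrix.of fun i j =>
    if j.val = 0 then (if i.val < k then c i else if i.val = k then 1 else 0)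
    else if j.val ≤ k then (if i.val + 1 = j.val then 1 else 0)
    else if i.val = j.val then 1 else 0

theorem colMat_zero (c : ℕ → F) : colMat n 0 c = 1 := by
  ext i j
  rw [Matrix.one_apply]
  simp only [colMat, Matrix.of_apply, Fin.ext_iff]
  split_ifs <;> first | rfl | omega

/-- The swap moves the 1 of the first column from row k to row k + 1. That row then has no other
nonzero entry, so the transvection only writes c_k into row k of the first column. -/
theorem sElt_mul_colMat {k : ℕ} (hk : k + 1 < n) (c : ℕ → F) :
    (sElt k hk (c k)).val * colMat n k c = colMat n (k + 1) c := by
  ext i j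
  rw [sElt, Units.val_mul, Matrix.mul_assoc]
  change ((Matrix.transvection ⟨k, by omega⟩ ⟨k + 1, hk⟩ (c k) : Matrix (Fin n) (Fin n) F) *
    ((Matrix.swap F ⟨k, by omega⟩ ⟨k + 1, hk⟩ : Matrix (Fin n) (Fin n) F) * colMat n k c)) i j = _
  by_cases hi : i = ⟨k, by omega⟩
  · subst hi
    rw [Matrix.transvection_mul_apply_same, Matrix.swap_mul_apply_left,
      Matrix.swap_mul_apply_right]
    simp only [colMat, Matrix.of_apply]
    split_ifs <;> first | omega | simp
  · rw [Matrix.transvection_mul_apply_of_ne (ha := hi)]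
    by_cases hi' : i = ⟨k + 1, hk⟩
    · subst hi'
      rw [Matrix.swap_mul_apply_right]
      simp only [colMat, Matrix.of_apply]
      split_ifs <;> first | rfl | omega
    · rw [Matrix.swap_mul_of_ne hi hi']
      simp only [Fin.ext_iff] at hi hi'
      simp only [colMat, Matrix.of_apply]
      split_ifs <;> first | rfl | omega

theorem sProd_mul_colMat (l : ℕ) (c : ℕ → F) : ∀ (m : ℕ) (h : l + m < n) (a : Fin m → F),
    (∀ i, a i = c (l + i)) → (sProd l m h a).val * colMat n l c = colMat n (l + m) c
  | 0, _, _, _ => by simp [sProd]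
  | m + 1, h, a, ha => by
    rw [sProd, Units.val_mul, Matrix.mul_assoc,
      sProd_mul_colMat l c m (by omega) (Fin.init a) fun i => ha i.castSucc, ha (Fin.last m)]
    exact sElt_mul_colMat (k := l + m) h c

/-- The element `s_k(c_{k-1}) ⋯ s_1(c_0)`. -/
def colElt (k : Fin n) (c : ℕ → F) : GL (Fin n) F := sProd 0 k.val (by omega) fun i => c i

theorem colElt_val (k : Fin n) (c : ℕ → F) : (colElt k c).val = colMat n k c := by
  have := sProd_mul_colMat (n := n) 0 c k.val (by omega) (fun i => c i) fun i => by rw [zero_add]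
  rw [colMat_zero, Matrix.mul_one] at this
  exact this.trans (by rw [zero_add])

theorem sProd_mul_sProd (k : Fin n) {l m : ℕ} (hlm : l + m = k.val) (a : Fin m → F)
    (b : Fin l → F) (c : ℕ → F) (ha : ∀ i, a i = c (l + i)) (hb : ∀ i, b i = c i) :
    sProd l m (by omega) a * sProd 0 l (by omega) b = colElt k c := by
  have h1 := sProd_mul_colMat (n := n) 0 c l (by omega) b fun i => by rw [zero_add, hb]
  rw [colMat_zero, Matrix.mul_one] at h1
  replace h1 := h1.trans (by rw [zero_add] : _ = colMat n l c)
  refine Units.ext ?_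
  rw [Units.val_mul, h1, sProd_mul_colMat l c m (by omega) a ha, hlm, colElt_val]

theorem colMat_apply_zero [NeZero n] (k : ℕ) (c : ℕ → F) (i : Fin n) :
    colMat n k c i 0 = if i.val < k then c i else if i.val = k then 1 else 0 := by
  simp [colMat]

/-- Changing the first `h` entries of `c` multiplies by an element of `U_h` from the left. -/
theorem exists_unipFrom_mul_colElt (h : ℕ) (k : Fin n) {c c' : ℕ → F}
    (hc : ∀ i, h ≤ i → i < k.val → c i = c' i) :
    ∃ u ∈ unipFrom n F h, colElt k c = u * colElt k c' := by
  refine ⟨colElt k c * (colElt k c')⁻¹, ?_, by group⟩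
  -- Row k of `colMat n k c'` has a single nonzero entry, a 1 in column 0. So D, supported in column
  -- k, changes just the first column, and the element of U_h is 1 + D.
  let D : Matrix (Fin n) (Fin n) F :=
    Matrix.of fun i j => if j = k ∧ i < k then c i - c' i else 0
  have hD : D * colMat n k c' = colMat n k c - colMat n k c' := by
    ext i j
    rw [Matrix.mul_apply, Finset.sum_eq_single k, Matrix.sub_apply]
    · simp only [D, colMat, Matrix.of_apply, Fin.lt_def, true_and]
      split_ifs <;> first | omega | simp
    · intro m _ hm
      simp [D, hm]
    · simp
  have hu : (colElt k c * (colElt k c')⁻¹).val = 1 + D := by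
    have h2 : (1 + D) * (colElt k c').val = (colElt k c).val := by
      rw [colElt_val, colElt_val, add_mul, hD, one_mul, add_sub_cancel]
    rw [Units.val_mul, ← h2, Matrix.mul_assoc, ← Units.val_mul, mul_inv_cancel, Units.val_one,
      mul_one]
  change IsStrictUpper h _
  rw [hu, add_sub_cancel_left]
  intro i j hij
  simp only [D, Matrix.of_apply]
  split_ifs with hjk
  · obtain ⟨rfl, hik⟩ := hjk
    rw [hc i (by simp only [hik, true_and] at hij; omega) hik, sub_self]
  · rfl

/-- The permutation of the basis vectors given by `s_k ⋯ s_1`. -/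
def cycleIdx (k j : Fin n) : Fin n :=
  if j.val = 0 then k else if j.val ≤ k.val then ⟨j.val - 1, by omega⟩ else j

theorem cycleIdx_val (k j : Fin n) : (cycleIdx k j).val =
    if j.val = 0 then k.val else if j.val ≤ k.val then j.val - 1 else j.val := by
  rw [cycleIdx]
  split_ifs <;> rfl

theorem cycleIdx_injective (k : Fin n) : Function.Injective (cycleIdx k) := by
  intro i j hij
  have := congrArg Fin.val hij
  rw [cycleIdx_val, cycleIdx_val] at this
  refine Fin.ext ?_
  split_ifs at this <;> omega

theorem colMat_zero_apply (k i j : Fin n) :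
    colMat n k (0 : ℕ → F) i j = if i = cycleIdx k j then 1 else 0 := by
  simp only [Fin.ext_iff, cycleIdx_val, colMat, Matrix.of_apply, Pi.zero_apply]
  split_ifs <;> first | rfl | omega

/-- With zero labels the element is a permutation matrix, and conjugation relabels entries. -/
theorem conj_colElt_zero_apply (k i j : Fin n) (p : GL (Fin n) F) :
    (colElt k 0 * p * (colElt k 0)⁻¹).val (cycleIdx k i) (cycleIdx k j) = p.val i j := by
  set Z := colElt k 0 * p * (colElt k 0)⁻¹ with hZ
  have h : Z.val * colMat n k 0 = colMat n k 0 * p.val := by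
    rw [← colElt_val, ← Units.val_mul, ← Units.val_mul, hZ, inv_mul_cancel_right]
  have h' := congrFun (congrFun h (cycleIdx k i)) j
  rw [Matrix.mul_apply, Matrix.mul_apply, Finset.sum_eq_single (cycleIdx k j),
    Finset.sum_eq_single i] at h'
  · simpa [colMat_zero_apply] using h'
  · intro m _ hm
    rw [colMat_zero_apply, if_neg fun e => hm (cycleIdx_injective k e).symm, zero_mul]
  · simp
  · intro m _ hm
    rw [colMat_zero_apply, if_neg hm, mul_zero]
  · simp

theorem one_cycleIdx (k i j : Fin n) : (1 : Matrix (Fin n) (Fin n) F) (cycleIdx k i) (cycleIdx k j) =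
    (1 : Matrix (Fin n) (Fin n) F) i j := by
  simp [Matrix.one_apply, (cycleIdx_injective k).eq_iff]

/-- The labels do not matter: they amount to a unitriangular left factor t, which normalizes U_h.
What remains is conjugation by a permutation. -/
theorem conj_colElt_mem_iff (h : ℕ) (k : Fin n) (c : ℕ → F) (p : GL (Fin n) F) :
    colElt k c * p * (colElt k c)⁻¹ ∈ unipFrom n F h ↔
      ∀ i j, ¬ (cycleIdx k i < cycleIdx k j ∧ (cycleIdx k i).val < h) →
        p.val i j = (1 : Matrix (Fin n) (Fin n) F) i j := by
  -- Taking k itself for the row bound makes the agreement condition on c and 0 vacuous.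
  obtain ⟨t, ht, hct⟩ := exists_unipFrom_mul_colElt (n := n) k.val k (c := c) (c' := 0)
    fun i h1 h2 => absurd h1 (by omega)
  rw [hct, show t * colElt k 0 * p * (t * colElt k 0)⁻¹ =
    t * (colElt k 0 * p * (colElt k 0)⁻¹) * t⁻¹ by group, conj_mem_unipFrom_iff ht, mem_unipFrom]
  have hs : Function.Surjective (cycleIdx k) := Finite.surjective_of_injective (cycleIdx_injective k)
  rw [hs.forall]
  refine forall_congr' fun i => ?_
  rw [hs.forall]
  refine forall_congr' fun j => ?_
  rw [conj_colElt_zero_apply, one_cycleIdx]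

/-! ### Representatives of the double cosets of U_h and P -/

/-- The sequence with values `a` from the index `l` on. -/
def shiftLabels {m : ℕ} (l : ℕ) (a : Fin m → F) (i : ℕ) : F :=
  if h : l ≤ i ∧ i - l < m then a ⟨i - l, h.2⟩ else 0

theorem shiftLabels_add {m : ℕ} (l : ℕ) (a : Fin m → F) (i : Fin m) :
    shiftLabels l a (l + i) = a i := by
  rw [shiftLabels, dif_pos ⟨by omega, by omega⟩]
  exact congrArg a (Fin.ext (by simp))

/-- Labels of the `U_h`-orbits on `G / P`. -/
abbrev OrbitIdx (n : ℕ) (F : Type u) (h : ℕ) : Type u :=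
  Σ k : Fin n, Fin (k.val - min k.val h) → F

/-- Representatives of `U_h \\ G / P`. -/
def orbitRep {h : ℕ} (i : OrbitIdx n F h) : GL (Fin n) F :=
  colElt i.1 (shiftLabels (min i.1.val h) i.2)

/-- The starred labels b sit in rows below index h of the first column, exactly where U_h can change
them. This is why a starred box carries an average and no label. -/
theorem sProd_mul_sProd_eq_unipFrom_mul {h : ℕ} (i : OrbitIdx n F h)
    (b : Fin (min i.1.val h) → F) : ∃ u ∈ unipFrom n F h,
    sProd (min i.1.val h) (i.1.val - min i.1.val h) (by omega) i.2 *
      sProd 0 (min i.1.val h) (by omega) b = u * orbitRep i := by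
  obtain ⟨k, a⟩ := i
  dsimp only at a b ⊢
  let c : ℕ → F := fun x => if hx : x < min k.val h then b ⟨x, hx⟩ else
    shiftLabels (min k.val h) a x
  have hc : ∀ x, min k.val h ≤ x → c x = shiftLabels (min k.val h) a x := fun x hx =>
    dif_neg (by omega)
  have hcb : ∀ x : Fin (min k.val h), c x = b x := fun x => dif_pos x.2
  obtain ⟨u, hu, hcu⟩ := exists_unipFrom_mul_colElt h k (c := c)
    (c' := shiftLabels (min k.val h) a) fun i hi _ => hc i (by omega)
  refine ⟨u, hu, (sProd_mul_sProd k (by omega) a b c (fun x => ?_) fun x => (hcb x).symm).trans hcu⟩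
  rw [hc _ (by omega), shiftLabels_add]

variable [NeZero n]

theorem toLevi_val_apply (p : parabolic n F) (i j : Fin n) :
    (toLevi n F p).val.val i j = if (i = 0 ↔ j = 0) then p.val.val i j else 0 := rfl

/-- The stabilizer in `U_h` of the coset of `s_k(c_{k-1}) ⋯ s_1(c_0)` acts through the next of the
groups `U_h`. -/
theorem toLevi_mem_of_conj_mem {h : ℕ} {k : Fin n} {c : ℕ → F} {p : parabolic n F}
    (hp : colElt k c * p.val * (colElt k c)⁻¹ ∈ unipFrom n F h) :
    (toLevi n F p).val ∈ unipFrom n F (nextHeight h k) := by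
  rw [conj_colElt_mem_iff] at hp
  rw [mem_unipFrom]
  intro i j hij
  rw [toLevi_val_apply]
  split_ifs with h0
  · refine hp i j fun hσ => hij ?_
    rw [Fin.lt_def, cycleIdx_val, cycleIdx_val] at hσ
    simp only [Fin.ext_iff, Fin.val_zero] at h0
    rw [Fin.lt_def, nextHeight]
    split_ifs at hσ <;> omega
  · rw [Matrix.one_apply_ne]
    rintro rfl
    exact h0 Iff.rfl

/-- A converse of `toLevi_mem_of_conj_mem` for Levi parts. On indices i ≥ 1 the permutation
preserves the order, and for i ≠ 0 its value is less than h exactly when i < `nextHeight h k`.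
Entries (0, j) may move below the diagonal, so p itself need not work. -/
theorem conj_toLevi_mem {h : ℕ} (k : Fin n) (c : ℕ → F) {p : parabolic n F}
    (hp : p.val ∈ unipFrom n F (nextHeight h k)) :
    colElt k c * (toLevi n F p).val * (colElt k c)⁻¹ ∈ unipFrom n F h := by
  rw [conj_colElt_mem_iff]
  rw [mem_unipFrom] at hp
  intro i j hij
  rw [toLevi_val_apply]
  split_ifs with h0
  · by_cases hi : i = j
    · subst hi
      exact hp i i (by simp)
    refine hp i j fun hlt => hij ?_
    rw [Fin.lt_def, cycleIdx_val, cycleIdx_val]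
    simp only [Fin.ext_iff, Fin.val_zero] at h0
    rw [Fin.lt_def, nextHeight] at hlt
    split_ifs <;> omega
  · rw [Matrix.one_apply_ne]
    rintro rfl
    exact h0 Iff.rfl

/-- The double coset `U_h s_k(c_{k-1}) ⋯ s_1(c_0) P` determines `k` and the `c_i` with `h ≤ i`. -/
theorem eq_of_colElt_mem {h : ℕ} {k k' : Fin n} {c c' : ℕ → F} {u : GL (Fin n) F}
    (hu : u ∈ unipFrom n F h) (hp : (colElt k c)⁻¹ * (u * colElt k' c') ∈ parabolic n F) :
    k = k' ∧ ∀ i, h ≤ i → i < k.val → c i = c' i := by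
  obtain ⟨p, hpdef⟩ : ∃ p, p = (colElt k c)⁻¹ * (u * colElt k' c') := ⟨_, rfl⟩
  rw [← hpdef] at hp
  have heq : colElt k c * p = u * colElt k' c' := by rw [hpdef]; group
  clear hpdef
  rw [mem_unipFrom] at hu
  -- Only first columns are compared: the first column of p is p_00 times the first unit vector.
  have hcol : ∀ x : Fin n, colMat n k c x 0 * p.val 0 0 = ∑ m, u.val x m * colMat n k' c' m 0 := by
    intro x
    have h0 : (colElt k c).val * p.val = u.val * (colElt k' c').val := by
      rw [← Units.val_mul, heq, Units.val_mul]
    have h1 := congrFun (congrFun h0 x) 0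
    rw [Matrix.mul_apply, Matrix.mul_apply,
      Finset.sum_eq_single 0] at h1
    · rwa [colElt_val, colElt_val] at h1
    · intro m _ hm
      rw [hp m hm, mul_zero]
    · simp
  -- In these rows u is unitriangular and the column vanishes below row k', so u has no effect.
  have hge : ∀ x : Fin n, k' ≤ x → ∑ m, u.val x m * colMat n k' c' m 0 = colMat n k' c' x 0 := by
    intro x hx
    rw [Finset.sum_eq_single x]
    · rw [hu x x (by simp), Matrix.one_apply_eq, one_mul]
    · intro m _ hm
      by_cases hmx : m < x
      · rw [hu x m (fun h => absurd h.1 hmx.not_gt), Matrix.one_apply_ne (Ne.symm hm), zero_mul]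
      · rw [colMat_apply_zero]
        have : m.val ≠ x.val := fun e => hm (Fin.ext e)
        simp only [Fin.lt_def, Fin.le_def] at hmx hx
        rw [if_neg (by omega), if_neg (by omega), mul_zero]
    · simp
  have hrow : ∀ x : Fin n, h ≤ x.val →
      ∑ m, u.val x m * colMat n k' c' m 0 = colMat n k' c' x 0 := by
    intro x hx
    rw [Finset.sum_eq_single x]
    · rw [hu x x (by simp), Matrix.one_apply_eq, one_mul]
    · intro m _ hm
      rw [hu x m (by omega), Matrix.one_apply_ne (Ne.symm hm), zero_mul]
    · simp
  have hk' : colMat n k c k' 0 * p.val 0 0 = 1 := by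
    rw [hcol, hge k' le_rfl, colMat_apply_zero]
    simp
  have hle : k'.val ≤ k.val := by
    by_contra hlt
    rw [colMat_apply_zero, if_neg (by omega), if_neg (by omega), zero_mul] at hk'
    exact zero_ne_one hk'
  have hkk : k = k' := by
    by_contra hne
    have hne' : k.val ≠ k'.val := fun e => hne (Fin.ext e)
    -- If k > k', the pivot 1 in row k on the left meets a 0 on the right.
    have h0 : p.val 0 0 = 0 := by
      have := hcol k
      rw [hge k hle, colMat_apply_zero, colMat_apply_zero] at this
      rw [if_neg (by omega), if_pos rfl, if_neg (by omega), if_neg (by omega), one_mul] at this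
      exact this
    rw [h0, mul_zero] at hk'
    exact zero_ne_one hk'
  subst hkk
  have hp0 : p.val 0 0 = 1 := by
    rw [colMat_apply_zero] at hk'
    simpa using hk'
  refine ⟨rfl, fun i hi hik => ?_⟩
  have := hcol ⟨i, by omega⟩
  rw [hrow ⟨i, by omega⟩ hi, hp0, mul_one, colMat_apply_zero, colMat_apply_zero] at this
  simpa [hik] using this

theorem exists_colElt_mul (x : GL (Fin n) F) :
    ∃ (k : Fin n) (c : ℕ → F) (p : parabolic n F), x = colElt k c * p.val := by
  classical
  obtain ⟨i, hi⟩ : ∃ i, x.val i 0 ≠ 0 := by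
    by_contra! h0
    have h1 : (x⁻¹.val * x.val) 0 0 = (1 : Matrix (Fin n) (Fin n) F) 0 0 := by
      rw [← Units.val_mul, inv_mul_cancel, Units.val_one]
    rw [Matrix.mul_apply, Finset.sum_eq_zero fun m _ => by rw [h0 m, mul_zero]] at h1
    simp at h1
  -- k is the row of the last nonzero entry of the first column; dividing by that pivot gives c.
  -- Then x and `colElt k c` have proportional first columns, so they differ by an element of P.
  obtain ⟨k, hk, hmax⟩ := (Finset.univ.filter fun i => x.val i 0 ≠ 0).exists_max_image id
    ⟨i, by simpa using hi⟩
  simp only [Finset.mem_filter, Finset.mem_univ, true_and, id] at hk hmax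
  let c : ℕ → F := fun i => if h : i < n then x.val ⟨i, h⟩ 0 / x.val k 0 else 0
  have hc : ∀ m, x.val m 0 = colMat n k c m 0 * x.val k 0 := by
    intro m
    rw [colMat_apply_zero]
    split_ifs with h1 h2
    · simp [c, hk]
    · rw [one_mul, Fin.ext h2]
    · rw [zero_mul]
      by_contra hne
      have := hmax m hne
      rw [Fin.le_def] at this
      omega
  refine ⟨k, c, ⟨(colElt k c)⁻¹ * x, fun i hi => ?_⟩, by simp⟩
  rw [Units.val_mul, Matrix.mul_apply, Finset.sum_congr rfl (g := fun m =>
    ((colElt k c)⁻¹.val i m * (colElt k c).val m 0) * x.val k 0)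
    (fun m _ => by rw [hc m, colElt_val, mul_assoc]), ← Finset.sum_mul, ← Matrix.mul_apply,
    ← Units.val_mul, inv_mul_cancel, Units.val_one, Matrix.one_apply_ne hi, zero_mul]

theorem orbitRep_disjoint {h : ℕ} (i j : OrbitIdx n F h) (u : GL (Fin n) F)
    (hu : u ∈ unipFrom n F h) (hp : (orbitRep i)⁻¹ * (u * orbitRep j) ∈ parabolic n F) :
    i = j := by
  obtain ⟨k, a⟩ := i
  obtain ⟨k', a'⟩ := j
  obtain ⟨hk, hc⟩ := eq_of_colElt_mem hu hp
  dsimp only at hk hc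
  subst hk
  congr
  funext x
  have := hc (min k.val h + x) (by omega) (by omega)
  rwa [shiftLabels_add, shiftLabels_add] at this

theorem orbitRep_cover (h : ℕ) (x : GL (Fin n) F) : ∃ i : OrbitIdx n F h,
    ∃ u ∈ unipFrom n F h, ∃ p : parabolic n F, x = u * (orbitRep i * p.val) := by
  obtain ⟨k, c, p, rfl⟩ := exists_colElt_mul x
  let a : Fin (k.val - min k.val h) → F := fun i => c (min k.val h + i)
  obtain ⟨u, hu, hcu⟩ := exists_unipFrom_mul_colElt h k (c := c)
    (c' := shiftLabels (min k.val h) a) (by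
      intro i hi hik
      have := shiftLabels_add (min k.val h) a ⟨i - min k.val h, by omega⟩
      rw [show min k.val h + (i - min k.val h) = i by omega] at this
      rw [this]
      simp only [a]
      congr 1
      omega)
  exact ⟨⟨k, a⟩, u, hu, p, by rw [hcu, orbitRep, mul_assoc]⟩

end Columns

/-! ### The fixed vectors of `U_h` in `IR^r` -/

theorem avg_congr {G V : Type*} [Group G] [AddCommGroup V] [Module ℂ V]
    (ρ : Representation ℂ G V) {H H' : Subgroup G} [Fintype H] [Fintype H'] (h : H = H') :
    avg ρ H = avg ρ H' := by
  subst h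
  congr!

section Fixed

variable {n : ℕ} [NeZero n] {F : Type u} [Field F] [Fintype F]

omit [Fintype F] in
theorem algTmul_of_mul_smul_sum (V : Rep.{u} ℂ (levi n F)) {ι : Type*} [Fintype ι]
    (x : GL (Fin n) F) (y : ι → GL (Fin n) F) (t : ℂ) (v : V) :
    algTmul V (MonoidAlgebra.of ℂ _ x * (t • ∑ i, MonoidAlgebra.of ℂ _ (y i))) v =
      t • ∑ i, groupTmul V (x * y i) v := by
  have h : ∀ z, algTmul V z v = (Finsupp.linearCombination ℂ fun g => groupTmul V g v)
      (MonoidAlgebra.coeffLinearEquiv ℂ z) := fun _ => rfl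
  rw [h, mul_smul_comm, Finset.mul_sum, map_smul, map_smul, map_sum, map_sum]
  congr 1
  refine Finset.sum_congr rfl fun i _ => ?_
  rw [← map_mul]
  exact (Finsupp.linearCombination_single ℂ 1 (x * y i)).trans (one_smul _ _)

/-- All q^min(k,h) terms of the starred sum lie in U_h times the representative, so their averages
agree and the normalizing factor cancels their number. -/
theorem avg_algTmul_starW (V : Rep.{u} ℂ (levi n F)) {h : ℕ} (i : OrbitIdx n F h) (v : V) :
    avg (Indf V).ρ (unipFrom n F h)
        (algTmul V (starW i.1 (min i.1.val h) (min_le_left _ _) i.2) v) =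
      avg (Indf V).ρ (unipFrom n F h) (groupTmul V (orbitRep i) v) := by
  rw [starW, algTmul_of_mul_smul_sum, map_smul, map_sum,
    Finset.sum_congr rfl (g := fun _ => avg (Indf V).ρ (unipFrom n F h)
      (groupTmul V (orbitRep i) v))]
  · have := sum_inv_card_smul (ι := Fin (min i.1.val h) → F)
      (avg (Indf V).ρ (unipFrom n F h) (groupTmul V (orbitRep i) v))
    rwa [Fintype.card_fun, Fintype.card_fin, Nat.cast_pow] at this
  · intro b _
    obtain ⟨u, hu, hub⟩ := sProd_mul_sProd_eq_unipFrom_mul i b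
    rw [hub, avg_groupTmul_mul _ _ hu]

/-- The U-factor of an element of U_{h'} is absorbed by e_U, and its Levi part stabilizes the coset.
Hence the averages from the induction hypothesis can be inserted without changing the vector. -/
theorem avg_groupTmul_toResf_avg (V : Rep.{u} ℂ (GL (Fin n) F)) {h : ℕ} (i : OrbitIdx n F h)
    (v : V) :
    avg (Indf (Resf V)).ρ (unipFrom n F h) (groupTmul (Resf V) (orbitRep i)
        (toResf V (avg V.ρ (unipFrom n F (nextHeight h i.1)) v))) =
      avg (Indf (Resf V)).ρ (unipFrom n F h)
        (groupTmul (Resf V) (orbitRep i) (toResf V v)) := by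
  refine apply_avg_eq V.ρ _ ((avg (Indf (Resf V)).ρ (unipFrom n F h)) ∘ₗ
    (groupTmul (Resf V) (orbitRep i)) ∘ₗ toResf V) fun w hw => ?_
  let p : parabolic n F := ⟨w, unipFrom_le_parabolic _ hw⟩
  have h1 := avg_groupTmul_stabilizer (Resf V) (unipFrom n F h) (orbitRep i)
    ⟨(toLevi n F p).val, levi_le_parabolic (toLevi n F p).2⟩
    (conj_toLevi_mem (p := p) _ _ hw) (toResf V v)
  rw [toLevi_of_mem_levi, ← toResf_parabolic] at h1
  exact h1

theorem linearIndependent_of_resf_val {V : Rep.{u} ℂ (GL (Fin n) F)} {ι : Type*} {f : ι → Resf V}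
    {g : ι → V} (hfg : ∀ i, (f i).val = g i) (hg : LinearIndependent ℂ g) :
    LinearIndependent ℂ f := by
  obtain rfl : (fun i => (f i).val) = g := funext hfg
  exact LinearIndependent.of_comp (LinearMap.range (eUOp V)).subtype hg

theorem mem_span_of_resf_val {V : Rep.{u} ℂ (GL (Fin n) F)} {ι : Type*} {f : ι → Resf V}
    {g : ι → V} (hfg : ∀ i, (f i).val = g i) {v : Resf V}
    (hv : v.val ∈ Submodule.span ℂ (Set.range g)) : v ∈ Submodule.span ℂ (Set.range f) := by
  let f' : ι → LinearMap.range (eUOp V) := f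
  have hr : Set.range g = (LinearMap.range (eUOp V)).subtype '' Set.range f' :=
    (congrArg Set.range (funext fun i => (hfg i).symm)).trans (Set.range_comp _ f')
  rw [hr, ← Submodule.map_span] at hv
  obtain ⟨y, hy, hyv⟩ := hv
  have h : y = v := Subtype.ext hyv
  exact h ▸ hy

/-- For h ≥ 1 the group U_h contains U, so e_U fixes the average. Every value of `nextHeight` is at
least 1, which makes this available at each induction step. -/
theorem toResf_avg_val (V : Rep.{u} ℂ (GL (Fin n) F)) {h : ℕ} (hh : 1 ≤ h) (v : V) :
    (toResf V (avg V.ρ (unipFrom n F h) v)).val = avg V.ρ (unipFrom n F h) v := by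
  rw [toResf_val]
  refine avg_eq_self _ _ fun u hu => map_avg _ _ (unipFrom_mono hh ?_) v
  rwa [unipFrom_one]

theorem one_le_nextHeight (h k : ℕ) : 1 ≤ nextHeight h k := by
  unfold nextHeight
  omega

/-- The averages of the vectors `v_K` over `U_h`. -/
def avgVec {r h : ℕ} (K : QSetPartitionFrom n F r h) : IR n F r :=
  avg (IR n F r).ρ (unipFrom n F h) (iterTmul r K.column)

theorem avgVec_consEquiv {r h : ℕ} (x : Σ i : OrbitIdx n F h,
    QSetPartitionFrom n F r (nextHeight h i.1)) :
    avgVec (QSetPartitionFrom.consEquiv n F r h x) =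
      avg (Indf (Resf (IR n F r))).ρ (unipFrom n F h)
        (groupTmul (Resf (IR n F r)) (orbitRep x.1) (toResf (IR n F r) (avgVec x.2))) := by
  obtain ⟨⟨k, a⟩, K⟩ := x
  refine Eq.trans ?_ ((avg_algTmul_starW (Resf (IR n F r)) ⟨k, a⟩ _).trans
    (avg_groupTmul_toResf_avg (IR n F r) ⟨k, a⟩ _).symm)
  have h0 := QSetPartitionFrom.column_cons_zero k a K
  have h1 := QSetPartitionFrom.tail_column_cons k a K
  rw [← h1, ← h0]
  rfl

/-- The averages of the `v_K` over `U_h` form a basis of the space of `U_h`-fixed vectors. -/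
theorem avgVec_basis (r : ℕ) : ∀ h : ℕ,
    LinearIndependent ℂ (avgVec : QSetPartitionFrom n F r h → IR n F r) ∧
      ∀ w, avg (IR n F r).ρ (unipFrom n F h) w ∈
        Submodule.span ℂ (Set.range (avgVec : QSetPartitionFrom n F r h → IR n F r)) := by
  induction r with
  | zero =>
    intro h
    have htriv : ∀ w : IR n F 0, avg (IR n F 0).ρ (unipFrom n F h) w = w :=
      fun w => avg_eq_self _ _ fun _ _ => rfl
    have hone : ∀ K : QSetPartitionFrom n F 0 h, avgVec K = (ULift.up 1 : ULift.{u} ℂ) :=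
      fun K => htriv _
    constructor
    · refine LinearIndependent.of_subsingleton default ?_
      rw [hone]
      intro h0
      exact one_ne_zero (congrArg ULift.down h0)
    · intro w
      rw [htriv]
      have hw : w = (w : ULift.{u} ℂ).down • avgVec (default : QSetPartitionFrom n F 0 h) := by
        rw [hone]
        exact ULift.ext _ _ (mul_one _).symm
      rw [hw]
      exact Submodule.smul_mem _ _ (Submodule.subset_span ⟨_, rfl⟩)
  | succ r ih =>
    intro h
    let V := IR n F r
    let b : ∀ i : OrbitIdx n F h, QSetPartitionFrom n F r (nextHeight h i.1) → Resf V :=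
      fun i K => toResf V (avgVec K)
    have hval : ∀ i K, (b i K).val = avgVec K :=
      fun i K => toResf_avg_val V (one_le_nextHeight h _) _
    have hfix : ∀ i K, ∀ p : parabolic n F,
        orbitRep i * p.val * (orbitRep i)⁻¹ ∈ unipFrom n F h →
          (Resf V).ρ (toLevi n F p) (b i K) = b i K := by
      intro i K p hp
      refine Subtype.ext ?_
      rw [resf_smul_val, hval]
      exact map_avg _ _ (toLevi_mem_of_conj_mem hp) _
    have hb : ∀ i, LinearIndependent ℂ (b i) := fun i =>
      linearIndependent_of_resf_val (hval i) (ih _).1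
    have hspan : ∀ i v, (∀ p : parabolic n F,
        orbitRep i * p.val * (orbitRep i)⁻¹ ∈ unipFrom n F h →
          (Resf V).ρ (toLevi n F p) v = v) → v ∈ Submodule.span ℂ (Set.range (b i)) := by
      intro i v hv
      refine mem_span_of_resf_val (hval i) ?_
      -- A vector fixed by the stabilizer is fixed by U_{h'}: P acts on e_U V through L, and the
      -- Levi parts of U_{h'} come from the stabilizer. It thus equals its own average.
      rw [← avg_eq_self V.ρ (unipFrom n F (nextHeight h i.1)) (v := v.val)]
      · exact (ih (nextHeight h i.1)).2 v.val
      · intro w hw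
        let p : parabolic n F := ⟨w, unipFrom_le_parabolic _ hw⟩
        have h1 := hv ⟨(toLevi n F p).val, levi_le_parabolic (toLevi n F p).2⟩
          (conj_toLevi_mem (p := p) _ _ hw)
        rw [toLevi_of_mem_levi] at h1
        exact (resf_smul_toLevi_val V p v).symm.trans (congrArg Subtype.val h1)
    have hfam : (avgVec : QSetPartitionFrom n F (r + 1) h → IR n F (r + 1)) ∘
        QSetPartitionFrom.consEquiv n F r h = fun x => avg (Indf (Resf V)).ρ (unipFrom n F h)
          (groupTmul (Resf V) (orbitRep x.1) (b x.1 x.2)) := funext avgVec_consEquiv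
    let _ : ∀ i : OrbitIdx n F h, Fintype (QSetPartitionFrom n F r (nextHeight h i.1)) :=
      fun _ => Fintype.ofFinite _
    constructor
    · rw [← linearIndependent_equiv (QSetPartitionFrom.consEquiv n F r h), hfam]
      exact linearIndependent_avg_groupTmul (Resf V) (unipFrom n F h) orbitRep b
        orbitRep_disjoint hfix hb
    · intro w
      rw [← (QSetPartitionFrom.consEquiv n F r h).surjective.range_comp, hfam]
      exact avg_mem_span_groupTmul (Resf V) (unipFrom n F h) orbitRep b
        (orbitRep_cover h) hspan w

/-! ### The cases h = 0 and h = 1 -/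

theorem avgVec_zero {r : ℕ} (K : QSetPartitionFrom n F r 0) :
    avgVec K = vec (QSetPartitionFrom.equivZero n F r K) := by
  rw [avgVec, vec, QSetPartitionFrom.column_equivZero]
  refine avg_eq_self _ _ fun u hu => ?_
  rw [unipFrom_zero, Subgroup.mem_bot] at hu
  rw [hu, map_one, Module.End.one_apply]

theorem avgVec_one {r : ℕ} (K : QSetPartitionFrom n F r 1) :
    avgVec K = (vecHalf (QSetPartitionFrom.equivOne n F r K).val).val := by
  rw [avgVec, vecHalf, QSetPartitionFrom.column_equivOne, avg_congr _ unipFrom_one]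
  exact (toResf_val _ _).symm

/-- The basis `(v_K)` of `IR^r`. -/
def basisIR (n : ℕ) [NeZero n] (F : Type u) [Field F] [Fintype F] (r : ℕ) :
    Module.Basis (QSetPartitionFrom n F r 0) ℂ (IR n F r) :=
  Module.Basis.mk (avgVec_basis r 0).1 fun w _ => by
    have := (avgVec_basis r 0).2 w
    rwa [avg_eq_self] at this
    intro u hu
    rw [unipFrom_zero, Subgroup.mem_bot] at hu
    rw [hu, map_one, Module.End.one_apply]

/-- The basis `(v_K)` of `IR^{r+1/2}`. -/
def basisIRHalf (n : ℕ) [NeZero n] (F : Type u) [Field F] [Fintype F] (r : ℕ) :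
    Module.Basis (QSetPartitionFrom n F r 1) ℂ (IRHalf n F r) :=
  Module.Basis.mk (v := fun K => vecHalf (QSetPartitionFrom.equivOne n F r K).val)
    (linearIndependent_of_resf_val (fun K => (avgVec_one K).symm) (avgVec_basis r 1).1)
    fun w _ => mem_span_of_resf_val (fun K => (avgVec_one K).symm) (by
      rw [← avg_eq_self (IR n F r).ρ (unipFrom n F 1) (v := w.val)]
      · exact (avgVec_basis r 1).2 w.val
      · exact fun u hu => resf_val_fixed (IR n F r) w (by rwa [unipFrom_one] at hu))

theorem basisIR_apply {r : ℕ} (K : QSetPartitionFrom n F r 0) :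
    basisIR n F r K = vec (QSetPartitionFrom.equivZero n F r K) :=
  (Module.Basis.mk_apply _ _ K).trans (avgVec_zero K)

theorem basisIRHalf_apply {r : ℕ} (K : QSetPartitionFrom n F r 1) :
    basisIRHalf n F r K = vecHalf (QSetPartitionFrom.equivOne n F r K).val :=
  Module.Basis.mk_apply _ _ K

theorem halfIncl_vecHalf {r : ℕ} (K : QSetPartition n (r + 1) F) (hK : K.k 0 = 0) :
    halfIncl r (vecHalf K) = vec K := by
  change _ = algTmul (Resf (IR n F r)) (K.column 0)
    (toResf (IR n F r) (iterTmul r (Fin.tail K.column)))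
  rw [column_zero_of_empty K hK]
  refine Eq.symm ((Finsupp.sum_single_index ?_).trans (one_smul ℂ _))
  exact zero_smul ℂ _

end Fixed

end

end QPartition

theorem mainTheorem5 {F : Type*} [Field F] [Fintype F] (n : ℕ) [NeZero n] (r : ℕ) :
    ((∃ b : Module.Basis (QPartition.QSetPartition n r F) ℂ (QPartition.IR n F r),
        ∀ K, b K = QPartition.vec K) ∧
      Module.finrank ℂ (QPartition.IR n F r) = QPartition.d n r (Fintype.card F)) ∧
    ((Function.Injective (QPartition.halfIncl (n := n) (F := F) r) ∧
        ∃ b : Module.Basis {K : QPartition.QSetPartition n (r + 1) F // K.k 0 = 0} ℂ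
            (QPartition.IRHalf n F r),
          ∀ K, b K = QPartition.vecHalf K.val ∧
            QPartition.halfIncl r (b K) = QPartition.vec K.val) ∧
      (Module.finrank ℂ (QPartition.IRHalf n F r) : ℚ) =
        (QPartition.d n (r + 1) (Fintype.card F) : ℚ) /
          (QPartition.qInt (Fintype.card F) n : ℚ)) := by
  refine ⟨⟨⟨(QPartition.basisIR n F r).reindex (QPartition.QSetPartitionFrom.equivZero n F r),
    fun K => ?_⟩, ?_⟩, ⟨QPartition.groupTmul_one_injective _,
      (QPartition.basisIRHalf n F r).reindex (QPartition.QSetPartitionFrom.equivOne n F r),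
      fun K => ?_⟩, ?_⟩
  · rw [Module.Basis.reindex_apply, QPartition.basisIR_apply, Equiv.apply_symm_apply]
  · rw [Module.finrank_eq_nat_card_basis (QPartition.basisIR n F r),
      QPartition.card_qSetPartitionFrom_zero]
  · have h : (QPartition.basisIRHalf n F r).reindex
        (QPartition.QSetPartitionFrom.equivOne n F r) K = QPartition.vecHalf K.val := by
      rw [Module.Basis.reindex_apply, QPartition.basisIRHalf_apply,
        Equiv.apply_symm_apply]
    exact ⟨h, by rw [h, QPartition.halfIncl_vecHalf K.val K.2]⟩
  · rw [Module.finrank_eq_nat_card_basis (QPartition.basisIRHalf n F r),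
      eq_div_iff (Nat.cast_ne_zero.mpr (QPartition.qInt_pos _ (NeZero.ne n)).ne'),
      ← QPartition.qInt_mul_card_qSetPartitionFrom_one, Nat.cast_mul, mul_comm]
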